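/- **Setting.** An operator-valued probability space $(\mathcal A,\phi,B)$ consists of a unital complex algebra $\mathcal A$, a unital subalgebra $B\subset\mathcal A$ and a linear map $\phi:\mathcal A\to B$ with $\phi(b)=b$ and $\phi(b_1ab_2)=b_1\phi(a)b_2$ for $b,b_1,b_2\in B$, $a\in\mathcal A$. Random variables $a,b\in\mathcal A$ are *free* (over $B$) if $\phi(x_1\cdots x_m)=0$ for all $m\ge 1$ whenever $\phi(x_j)=0$ for all $j$ and the $x_j$ lie alternatingly in the subalgebra generated by $B$ and $a$ and in the subalgebra generated by $B$ and $b$. A *multilinear function series* is a sequence $\alpha=(\alpha_n)_{n\ge 0}$ of $\mathbb C$-multilinear maps $\alpha_n:B^n\to B$, where $\alpha_0\in B$. Concatenation is $$(\alpha\cdot\beta)_n(b_1,\dots,b_n)=\sum_{k=0}^n\alpha_k(b_1,\dots,b_k)\,\beta_{n-k}(b_{k+1},\dots,b_n),$$ with unit $1=(1_B,0,0,\dots)$. Composition, for $\beta_0=0$, is $(\alpha\times\beta)_0=\alpha_0$ and, for $n\ge1$, $$(\alpha\times\beta)_n(b_1,\dots,b_n)=\sum_{k=1}^n\ \sum_{\substack{p_1+\dots+p_k=n\\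 p_i\ge1}}\alpha_k\big(\beta_{p_1}(b_1,\dots,b_{p_1}),\dots,\beta_{p_k}(b_{n-p_k+1},\dots,b_n)\big),$$ with unit $I=(0,\mathrm{id}_B,0,\dots)$. The *free cumulants* $\kappa_n:\mathcal A^n\to B$, $n\ge1$, are determined by the moment-cumulant formula $\phi(a_1\cdots a_n)=\sum_{\pi\in NC(n)}\kappa_\pi(a_1,\dots,a_n)$, where $NC(n)$ is the set of non-crossing partitions of $\{1,\dots,n\}$ and $\kappa_\pi$ applies to each block $V$ of $\pi$ the map $\kappa_{|V|}$, the blocks being nested into each other as in $\pi$. For $a\in\mathcal A$ let $K_a$ be the series with $K_{a,0}=\kappa_1(a)=\phi(a)$ and $K_{a,n}(b_1,\dots,b_n)=\kappa_{n+1}(ab_1,\dots,ab_n,a)$. If $\phi(a)=1_B$, the *$T$-transform* of $a$ is the unique multilinear function series $T_a$ with $$K_a=T_a\times(I\cdot K_a).$$ **Theorem.** Let $a,b\in\mathcal A$ be free random variables with $\phi(a)=\phi(b)=1_B$. Then $\phi(ab)=1_B$, the series $T_b$ has a two-sided inverse $T_b^{-1}$ with respect to concatenation, and $$T_{ab}=\big(T_a\times[\,T_b\cdot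 I\cdot T_b^{-1}\,]\big)\cdot T_b .$$ -/

import Mathlib

open Finset

/-- An (algebraic) operator-valued probability space `(A, φ, B)`: unital complex algebras `A`, `B`,
a unital algebra map `incl : B → A` (it is injective because of `φ_incl`, and it makes `A` a
`B`-`B`-bimodule and lets `B` be regarded as a unital subalgebra of `A`), and a conditional
expectation `φ : A → B`. -/
structure OpValuedSpace (A B : Type*) [Ring A] [Algebra ℂ A] [Ring B] [Algebra ℂ B] where
  /-- the inclusion of `B` in `A` -/
  incl : B →ₐ[ℂ] A
  /-- the conditional expectation -/
  φ : A →ₗ[ℂ] B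
  φ_incl : ∀ b : B, φ (incl b) = b
  φ_bimodule : ∀ (b₁ : B) (a : A) (b₂ : B), φ (incl b₁ * a * incl b₂) = b₁ * φ a * b₂

/-! ### Multilinear function series -/

/-- `Mult[[B]]`: sequences `(α₀, α₁, α₂, …)` of multilinear maps `αₙ : Bⁿ → B`; the map `α₀` of no
arguments is an element of `B`. -/
abbrev MultSeries (B : Type*) [Ring B] [Algebra ℂ B] : Type _ :=
  ∀ n : ℕ, MultilinearMap ℂ (fun _ : Fin n => B) B

namespace MultSeries

variable {B : Type*} [Ring B] [Algebra ℂ B]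

/-- The unit `1 = (1, 0, 0, …)` of the concatenation product. -/
noncomputable def one : MultSeries B
  | 0 => MultilinearMap.constOfIsEmpty ℂ (fun _ : Fin 0 => B) 1
  | _ + 1 => 0

/-- The unit `I = (0, id, 0, …)` of the composition product. -/
noncomputable def ident : MultSeries B
  | 1 => MultilinearMap.ofSubsingleton ℂ B B (0 : Fin 1) LinearMap.id
  | _ => 0

/-- The `k`-th summand of the degree `n` part of the concatenation product, namely the map
`(b₁, …, bₙ) ↦ α (b₁, …, bₖ) * β (bₖ₊₁, …, bₙ)`. -/
noncomputable def mulAt {n k : ℕ} (hk : k ≤ n) (α : MultilinearMap ℂ (fun _ : Fin k => B) B)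
    (β : MultilinearMap ℂ (fun _ : Fin (n - k) => B) B) :
    MultilinearMap ℂ (fun _ : Fin n => B) B :=
  ((LinearMap.mul' ℂ B).compMultilinearMap (α.domCoprod β)).domDomCongr
    (finSumFinEquiv.trans (finCongr (Nat.add_sub_cancel' hk)))

theorem mulAt_apply {n k : ℕ} (hk : k ≤ n) (α : MultilinearMap ℂ (fun _ : Fin k => B) B)
    (β : MultilinearMap ℂ (fun _ : Fin (n - k) => B) B) (b : Fin n → B) :
    mulAt hk α β b =
      α (fun i => b ⟨i, by omega⟩) * β (fun j => b ⟨k + j, by omega⟩) := rfl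

/-- The concatenation product
`(α · β)ₙ (b₁, …, bₙ) = ∑_{k=0}^{n} αₖ (b₁, …, bₖ) * βₙ₋ₖ (bₖ₊₁, …, bₙ)`. -/
noncomputable def concat (α β : MultSeries B) : MultSeries B := fun n =>
  ∑ k : Fin (n + 1), mulAt (Nat.lt_succ_iff.mp k.isLt) (α k) (β (n - k))

/-- For a composition `c = (p₁, …, pₖ)` of `n` (all `pᵢ ≥ 1`) the map
`(b₁, …, bₙ) ↦ f (β_{p₁} (b₁, …, b_{p₁}), …, β_{pₖ} (b_{n - pₖ + 1}, …, bₙ))`. -/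
noncomputable def compAlong {n : ℕ} (c : Composition n)
    (f : MultilinearMap ℂ (fun _ : Fin c.length => B) B) (β : MultSeries B) :
    MultilinearMap ℂ (fun _ : Fin n => B) B :=
  (f.compMultilinearMap fun i => β (c.blocksFun i)).domDomCongr c.blocksFinEquiv

theorem compAlong_apply {n : ℕ} (c : Composition n)
    (f : MultilinearMap ℂ (fun _ : Fin c.length => B) B) (β : MultSeries B) (b : Fin n → B) :
    compAlong c f β b = f (fun i => β (c.blocksFun i) (b ∘ c.embedding i)) := rfl

/-- The composition product `α × β` (meaningful for `β₀ = 0`): `(α × β)₀ = α₀` and, for `n ≥ 1`,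
`(α × β)ₙ` is the sum over all `k` and all `p₁ + ⋯ + pₖ = n`, `pᵢ ≥ 1`, of
`αₖ (β_{p₁} (b₁, …, b_{p₁}), …, β_{pₖ} (b_{n - pₖ + 1}, …, bₙ))`. -/
noncomputable def comp (α β : MultSeries B) : MultSeries B := fun n =>
  ∑ c : Composition n, compAlong c (α c.length) β

end MultSeries

/-! ### Non-crossing partitions -/

/-- A partition `π` of `{1, …, n}` is non-crossing if `i < j < k < l` with `i, k` in one block and
`j, l` in one block forces the two blocks to coincide. -/
def IsNonCrossing {n : ℕ} (π : Finpartition (univ : Finset (Fin n))) : Prop :=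
  ∀ i j k l : Fin n, i < j → j < k → k < l →
    π.part i = π.part k → π.part j = π.part l → π.part i = π.part j

open Classical in
/-- `NC(n)`, the set of non-crossing partitions of `{1, …, n}`. -/
noncomputable def NC (n : ℕ) : Finset (Finpartition (univ : Finset (Fin n))) :=
  univ.filter IsNonCrossing

/-- The block of `π` of the least element of `S`, cut down to `S`. -/
def firstBlock {n : ℕ} (π : Finpartition (univ : Finset (Fin n))) (S : Finset (Fin n))
    (hS : S.Nonempty) : Finset (Fin n) :=
  π.part (S.min' hS) ∩ S

/-- The elements of `S` between `v` and the next element of `V` (all the elements of `S` after `v`,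
if `v` is the last element of `V`). -/
def gapAfter {n : ℕ} (S V : Finset (Fin n)) (v : Fin n) : Finset (Fin n) :=
  S.filter fun s => v < s ∧ ∀ w ∈ V, v < w → s < w

theorem card_gapAfter_lt {n : ℕ} {S : Finset (Fin n)} (V : Finset (Fin n)) {v : Fin n}
    (hv : v ∈ S) : (gapAfter S V v).card < S.card := by
  refine Finset.card_lt_card ⟨Finset.filter_subset _ _, fun h => ?_⟩
  have := h hv
  simp [gapAfter] at this

theorem firstBlock_subset {n : ℕ} (π : Finpartition (univ : Finset (Fin n))) (S : Finset (Fin n))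
    (hS : S.Nonempty) : firstBlock π S hS ⊆ S :=
  Finset.inter_subset_right

namespace OpValuedSpace

variable {A B : Type*} [Ring A] [Algebra ℂ A] [Ring B] [Algebra ℂ B] (E : OpValuedSpace A B)

/-- The restriction of `f_π (a₁, …, aₙ)` to the part `S` of `{1, …, n}`: the empty set gives `1`,
and otherwise, if `v₁ < ⋯ < vₖ` is the block of the least element of `S`, the value is
`fₖ (a_{v₁} g₁, …, a_{vₖ} gₖ)`, where `gᵢ ∈ B` is the value of the part of `S` that lies between
`vᵢ` and `vᵢ₊₁` (for `i = k`: after `vₖ`). -/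
noncomputable def nestedValue {n : ℕ} (f : ∀ k : ℕ, MultilinearMap ℂ (fun _ : Fin k => A) B)
    (π : Finpartition (univ : Finset (Fin n))) (a : Fin n → A) (S : Finset (Fin n)) : B :=
  if hS : S.Nonempty then
    f (firstBlock π S hS).card fun i =>
      a ((firstBlock π S hS).orderEmbOfFin rfl i) *
        E.incl (nestedValue f π a
          (gapAfter S (firstBlock π S hS) ((firstBlock π S hS).orderEmbOfFin rfl i)))
  else 1
termination_by S.card
decreasing_by
  exact card_gapAfter_lt _ (firstBlock_subset π S hS (Finset.orderEmbOfFin_mem _ _ _))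

/-- `nestedValue` over `S` does not see the arguments outside `S`. -/
theorem nestedValue_congr {n : ℕ} (f : ∀ k : ℕ, MultilinearMap ℂ (fun _ : Fin k => A) B)
    (π : Finpartition (univ : Finset (Fin n))) (a a' : Fin n → A) (S : Finset (Fin n))
    (h : ∀ i ∈ S, a i = a' i) : E.nestedValue f π a S = E.nestedValue f π a' S := by
  induction hc : S.card using Nat.strong_induction_on generalizing S with
  | _ N ih =>
    rw [nestedValue, nestedValue]
    split_ifs with hS
    · congr 1
      funext i
      have hi := firstBlock_subset π S hS (Finset.orderEmbOfFin_mem (firstBlock π S hS) rfl i)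
      rw [h _ hi, ih _ (hc ▸ card_gapAfter_lt _ hi) _ _ rfl]
      exact fun j hj => h j (Finset.filter_subset _ _ hj)
    · rfl

/-- `nestedValue` over `S` is linear in each argument indexed by an element of `S`. -/
theorem nestedValue_linear {n : ℕ} (f : ∀ k : ℕ, MultilinearMap ℂ (fun _ : Fin k => A) B)
    (π : Finpartition (univ : Finset (Fin n))) (a : Fin n → A) (i : Fin n) (S : Finset (Fin n))
    (hi : i ∈ S) :
    ∃ L : A →ₗ[ℂ] B, ∀ x, E.nestedValue f π (Function.update a i x) S = L x := by
  induction hc : S.card using Nat.strong_induction_on generalizing S with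
  | _ N ih =>
    have hS : S.Nonempty := ⟨i, hi⟩
    set V := firstBlock π S hS with hV
    have hVS : V ⊆ S := firstBlock_subset π S hS
    have hmin : S.min' hS ∈ V := by
      rw [hV, firstBlock, Finset.mem_inter]
      exact ⟨π.mem_part (Finset.mem_univ _), S.min'_mem hS⟩
    -- the leg `v j` that sees `i`
    obtain ⟨j, hj⟩ : ∃ j : Fin V.card,
        V.orderEmbOfFin rfl j = i ∨ i ∈ gapAfter S V (V.orderEmbOfFin rfl j) := by
      have hne : (V.filter (· ≤ i)).Nonempty :=
        ⟨_, Finset.mem_filter.2 ⟨hmin, S.min'_le i hi⟩⟩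
      have hm := Finset.max'_mem _ hne
      have hm' := fun w hw => Finset.le_max' (V.filter (· ≤ i)) w hw
      set m := (V.filter (· ≤ i)).max' hne
      rw [Finset.mem_filter] at hm
      have : m ∈ Set.range (V.orderEmbOfFin rfl) := by
        rw [Finset.range_orderEmbOfFin]; exact hm.1
      obtain ⟨j, hj⟩ := this
      refine ⟨j, ?_⟩
      rw [hj]
      rcases hm.2.eq_or_lt with h | h
      · exact Or.inl h
      · refine Or.inr (Finset.mem_filter.2 ⟨hi, h, fun w hw hmw => ?_⟩)
        by_contra hlt
        exact absurd (hm' w (Finset.mem_filter.2 ⟨hw, not_lt.1 hlt⟩)) (not_le.2 hmw)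
    -- the arguments of the first block
    let g : (Fin n → A) → Fin V.card → A := fun a l =>
      a (V.orderEmbOfFin rfl l) *
        E.incl (E.nestedValue f π a (gapAfter S V (V.orderEmbOfFin rfl l)))
    have hval : ∀ a, E.nestedValue f π a S = f V.card (g a) := fun a => by
      rw [nestedValue, dif_pos hS]
    -- no other leg sees `i`
    have hother : ∀ x l, l ≠ j → g (Function.update a i x) l = g a l := by
      intro x l hl
      have h1 : V.orderEmbOfFin rfl l ≠ i := by
        intro h
        rcases hj with hj | hj
        · exact hl ((V.orderEmbOfFin rfl).injective (h.trans hj.symm))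
        · have := (Finset.mem_filter.1 hj).2
          have h' := this.2 _ (Finset.orderEmbOfFin_mem V rfl l) (by rw [h]; exact this.1)
          rw [h] at h'
          exact lt_irrefl _ h'
      have h2 : i ∉ gapAfter S V (V.orderEmbOfFin rfl l) := by
        intro h
        have hl' := (Finset.mem_filter.1 h).2
        rcases hj with hj | hj
        · have h' := hl'.2 _ (Finset.orderEmbOfFin_mem V rfl j) (by rw [hj]; exact hl'.1)
          rw [hj] at h'
          exact lt_irrefl _ h'
        · have hj' := (Finset.mem_filter.1 hj).2
          rcases lt_or_gt_of_ne hl with hlj | hlj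
          · exact lt_asymm hj'.1 (hl'.2 _ (Finset.orderEmbOfFin_mem V rfl j)
              ((V.orderEmbOfFin rfl).strictMono hlj))
          · exact lt_asymm hl'.1 (hj'.2 _ (Finset.orderEmbOfFin_mem V rfl l)
              ((V.orderEmbOfFin rfl).strictMono hlj))
      simp only [g]
      rw [Function.update_of_ne h1, E.nestedValue_congr f π _ a]
      intro s hs
      refine Function.update_of_ne (fun h => h2 ?_) _ _
      rw [← h]; exact hs
    -- that leg depends linearly on the argument
    obtain ⟨M, hM⟩ : ∃ M : A →ₗ[ℂ] A, ∀ x, g (Function.update a i x) j = M x := by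
      rcases hj with hj | hj
      · refine ⟨LinearMap.mulRight ℂ
          (E.incl (E.nestedValue f π a (gapAfter S V (V.orderEmbOfFin rfl j)))), fun x => ?_⟩
        simp only [g, LinearMap.mulRight_apply]
        rw [E.nestedValue_congr f π _ a, hj, Function.update_self]
        intro s hs
        refine Function.update_of_ne (fun h => ?_) _ _
        have := (Finset.mem_filter.1 hs).2.1
        rw [h, hj] at this
        exact lt_irrefl _ this
      · have hjS := hVS (Finset.orderEmbOfFin_mem V rfl j)
        obtain ⟨L, hL⟩ := ih _ (hc ▸ card_gapAfter_lt V hjS) _ hj rfl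
        refine ⟨LinearMap.mulLeft ℂ (a (V.orderEmbOfFin rfl j)) ∘ₗ E.incl.toLinearMap ∘ₗ L,
          fun x => ?_⟩
        have hne : V.orderEmbOfFin rfl j ≠ i := ((Finset.mem_filter.1 hj).2.1).ne
        simp only [g, LinearMap.comp_apply, LinearMap.mulLeft_apply, AlgHom.toLinearMap_apply]
        rw [hL, Function.update_of_ne hne]
    refine ⟨(f V.card).toLinearMap (g a) j ∘ₗ M, fun x => ?_⟩
    rw [hval, LinearMap.comp_apply, MultilinearMap.toLinearMap_apply]
    congr 1
    funext l
    by_cases hl : l = j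
    · subst hl; rw [Function.update_self, hM]
    · rw [Function.update_of_ne hl, hother x l hl]

theorem nestedValue_congr_family {n : ℕ} (f f' : ∀ k : ℕ, MultilinearMap ℂ (fun _ : Fin k => A) B)
    (π : Finpartition (univ : Finset (Fin n))) (hπ : π.parts ≠ {univ})
    (h : ∀ k < n, f k = f' k) (a : Fin n → A) (S : Finset (Fin n)) :
    E.nestedValue f π a S = E.nestedValue f' π a S := by
  induction hc : S.card using Nat.strong_induction_on generalizing S with
  | _ N ih =>
    rw [nestedValue, nestedValue]
    split_ifs with hS
    · have hlt : (firstBlock π S hS).card < n := by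
        have hp : π.part (S.min' hS) ∈ π.parts := π.part_mem.2 (Finset.mem_univ _)
        have hne : π.part (S.min' hS) ≠ univ := by
          intro hu
          rw [hu] at hp
          refine hπ (Finset.eq_singleton_iff_unique_mem.2 ⟨hp, fun p hp' => ?_⟩)
          obtain ⟨x, hx⟩ := π.nonempty_of_mem_parts hp'
          exact π.eq_of_mem_parts hp' hp hx (Finset.mem_univ x)
        calc (firstBlock π S hS).card ≤ (π.part (S.min' hS)).card :=
              Finset.card_le_card Finset.inter_subset_left
          _ < (univ : Finset (Fin n)).card :=
              Finset.card_lt_card (Finset.ssubset_univ_iff.2 hne)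
          _ = n := by simp
      rw [h _ hlt]
      congr 1
      funext i
      have hi := firstBlock_subset π S hS (Finset.orderEmbOfFin_mem (firstBlock π S hS) rfl i)
      rw [ih _ (hc ▸ card_gapAfter_lt _ hi) _ rfl]
    · rfl

theorem nestedValue_oneBlock {n : ℕ} (hn : 0 < n)
    (f : ∀ k : ℕ, MultilinearMap ℂ (fun _ : Fin k => A) B)
    (π : Finpartition (univ : Finset (Fin n))) (hπ : π.parts = {univ}) (a : Fin n → A) :
    E.nestedValue f π a univ = f n a := by
  have hne : (univ : Finset (Fin n)).Nonempty := ⟨⟨0, hn⟩, Finset.mem_univ _⟩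
  have hb : firstBlock π univ hne = univ := by
    have hp : π.part ((univ : Finset (Fin n)).min' hne) ∈ π.parts :=
      π.part_mem.2 (Finset.mem_univ _)
    rw [hπ, Finset.mem_singleton] at hp
    rw [firstBlock, hp, Finset.inter_univ]
  have hg : ∀ v, gapAfter univ (firstBlock π univ hne) v = ∅ := by
    intro v
    rw [hb]
    refine Finset.filter_eq_empty_iff.2 fun s _ h => ?_
    exact lt_irrefl s (h.2 s (Finset.mem_univ s) h.1)
  have h0 : E.nestedValue f π a ∅ = 1 := by
    rw [nestedValue, dif_neg Finset.not_nonempty_empty]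
  have key : ∀ (V : Finset (Fin n)) (hV : V = univ),
      f V.card (fun i => a (V.orderEmbOfFin rfl i)) = f n a := by
    rintro V rfl
    have hh : ∀ (k : ℕ) (hk : (univ : Finset (Fin n)).card = k),
        f k (fun i => a ((univ : Finset (Fin n)).orderEmbOfFin hk i)) =
          f n a := by
      intro k hk
      obtain rfl : k = n := by rw [← hk]; simp
      congr 1
      funext i
      have := Finset.orderEmbOfFin_unique hk (f := id) (fun x => Finset.mem_univ _) strictMono_id
      rw [← this]; rfl
    exact hh _ rfl
  rw [nestedValue, dif_pos hne]
  simp only [hg, h0, map_one, mul_one]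
  exact key _ hb

/-- The multiplicative extension `f_π` of a family `fₖ : Aᵏ → B` to a (non-crossing) partition `π`
of `{1, …, n}`: the multilinear map `(a₁, …, aₙ) ↦ f_π (a₁, …, aₙ)` that applies `f` to each
block and nests the blocks into each other in the way `π` does. -/
noncomputable def nested {n : ℕ} (f : ∀ k : ℕ, MultilinearMap ℂ (fun _ : Fin k => A) B)
    (π : Finpartition (univ : Finset (Fin n))) : MultilinearMap ℂ (fun _ : Fin n => A) B where
  toFun a := E.nestedValue f π a univ
  map_update_add' {inst} a i x y := by
    obtain rfl : inst = instDecidableEqFin n := Subsingleton.elim _ _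
    obtain ⟨L, hL⟩ := E.nestedValue_linear f π a i univ (Finset.mem_univ i)
    rw [hL, hL, hL, map_add]
  map_update_smul' {inst} a i c x := by
    obtain rfl : inst = instDecidableEqFin n := Subsingleton.elim _ _
    obtain ⟨L, hL⟩ := E.nestedValue_linear f π a i univ (Finset.mem_univ i)
    rw [hL, hL, map_smul]

/-- The moment maps `(a₁, …, aₙ) ↦ φ (a₁ ⋯ aₙ)`. -/
noncomputable def moment (n : ℕ) : MultilinearMap ℂ (fun _ : Fin n => A) B :=
  E.φ.compMultilinearMap (MultilinearMap.mkPiAlgebraFin ℂ n A)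

/-- The operator-valued free cumulants `κₙ : Aⁿ → B`, defined inductively by the moment-cumulant
formula `φ (a₁ ⋯ aₙ) = ∑_{π ∈ NC(n)} κ_π (a₁, …, aₙ)`, in which the one-block partition
contributes `κₙ (a₁, …, aₙ)` and the other partitions have only blocks of size less than `n`. -/
noncomputable def cumulant (n : ℕ) : MultilinearMap ℂ (fun _ : Fin n => A) B :=
  E.moment n - ∑ π ∈ (NC n).filter (fun π => π.parts ≠ {univ}),
    E.nested (fun k => if k < n then cumulant k else 0) π
termination_by n

/-- The moment-cumulant formula `φ (a₁ ⋯ aₙ) = ∑_{π ∈ NC(n)} κ_π (a₁, …, aₙ)`. -/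
theorem moment_eq_sum_cumulant {n : ℕ} (hn : 0 < n) :
    E.moment n = ∑ π ∈ NC n, E.nested E.cumulant π := by
  have hne : (univ : Finset (Fin n)) ≠ ⊥ :=
    Finset.nonempty_iff_ne_empty.1 ⟨⟨0, hn⟩, Finset.mem_univ _⟩
  have h1 : (NC n).filter (fun π => ¬ π.parts ≠ {univ}) = {Finpartition.indiscrete hne} := by
    refine Finset.eq_singleton_iff_unique_mem.2 ⟨?_, fun π hπ => ?_⟩
    · simp only [NC, Finset.mem_filter, Finset.mem_univ, true_and, not_not]
      refine ⟨fun i j k l _ _ _ _ _ => ?_, rfl⟩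
      have : ∀ x, (Finpartition.indiscrete hne).part x = univ := fun x => by
        have h := (Finpartition.indiscrete hne).part_mem.2 (Finset.mem_univ x)
        exact Finset.mem_singleton.1 h
      rw [this, this]
    · have := not_not.1 (Finset.mem_filter.1 hπ).2
      exact Finpartition.ext this
  have h2 : E.nested E.cumulant (Finpartition.indiscrete hne) = E.cumulant n := by
    ext a
    exact E.nestedValue_oneBlock hn _ _ rfl a
  rw [← Finset.sum_filter_add_sum_filter_not (NC n) (fun π => π.parts ≠ {univ}), h1,
    Finset.sum_singleton, h2]
  conv_rhs => rw [cumulant]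
  have h3 : ∑ π ∈ (NC n).filter (fun π => π.parts ≠ {univ}), E.nested E.cumulant π =
      ∑ π ∈ (NC n).filter (fun π => π.parts ≠ {univ}),
        E.nested (fun k => if k < n then E.cumulant k else 0) π := by
    refine Finset.sum_congr rfl fun π hπ => ?_
    ext a
    exact E.nestedValue_congr_family _ _ π (Finset.mem_filter.1 hπ).2
      (fun k hk => (if_pos hk).symm) a univ
  rw [h3, add_sub_cancel]

/-- The multilinear function series `K_a` of the free cumulants of `a`,
`K_{a,n} (b₁, …, bₙ) = κₙ₊₁ (a b₁, …, a bₙ, a)`. Its constant term is `κ₁ (a) = φ (a)`. -/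
noncomputable def cumulantSeries (a : A) : MultSeries B := fun n =>
  (LinearMap.applyₗ a).compMultilinearMap
    ((E.cumulant (n + 1)).curryRight.compLinearMap
      fun _ => LinearMap.mulLeft ℂ a ∘ₗ E.incl.toLinearMap)

theorem cumulantSeries_apply (a : A) (n : ℕ) (b : Fin n → B) :
    E.cumulantSeries a n b =
      E.cumulant (n + 1) (Fin.snoc (α := fun _ => A) (fun i => a * E.incl (b i)) a) := rfl

theorem cumulantSeries_zero (a : A) (v : Fin 0 → B) : E.cumulantSeries a 0 v = E.φ a := by
  have h : E.cumulant 1 = E.moment 1 := by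
    rw [cumulant, sub_eq_self]
    refine Finset.sum_eq_zero fun π hπ => absurd ?_ (Finset.mem_filter.1 hπ).2
    have hp := π.part_mem.2 (Finset.mem_univ (0 : Fin 1))
    have hall : ∀ p ∈ π.parts, p = univ := fun p hp => by
      obtain ⟨x, hx⟩ := π.nonempty_of_mem_parts hp
      ext y
      simp only [Subsingleton.elim y x, hx, Finset.mem_univ]
    exact Finset.eq_singleton_iff_unique_mem.2
      ⟨Eq.subst (motive := fun s => s ∈ π.parts) (hall _ hp) hp, hall⟩
  rw [cumulantSeries_apply, h]
  simp [moment, Fin.snoc]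

/-- The `T`-transform of `a`, for `φ (a) = 1`: the solution `T_a` of `K_a = T_a × (I · K_a)`. In
degree `n` the composition of `n` into `n` ones contributes `T_{a,n}` to the right-hand side, and
the other compositions, of length less than `n`, contribute terms with `T_{a,k}`, `k < n`; this
determines `T_{a,n}` by induction. -/
noncomputable def tTransform (a : A) (n : ℕ) : MultilinearMap ℂ (fun _ : Fin n => B) B :=
  E.cumulantSeries a n - ∑ c : Composition n,
    if _h : c.length < n then
      MultSeries.compAlong c (tTransform a c.length)
        (MultSeries.concat MultSeries.ident (E.cumulantSeries a))
    else 0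
termination_by n

/-- The defining relation `K_a = T_a × (I · K_a)` of the `T`-transform. -/
theorem cumulantSeries_eq_comp (a : A) (ha : E.φ a = 1) :
    E.cumulantSeries a =
      MultSeries.comp (E.tTransform a) (MultSeries.concat MultSeries.ident (E.cumulantSeries a)) := by
  funext n
  set β := MultSeries.concat MultSeries.ident (E.cumulantSeries a) with hβ
  have hβ1 : ∀ (m : ℕ) (_ : m = 1) (v : Fin m → B) (i : Fin m), β m v = v i := by
    rintro m rfl v i
    obtain rfl := Subsingleton.elim i 0
    have h0 : E.cumulantSeries a 0 = MultilinearMap.constOfIsEmpty ℂ _ 1 := by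
      ext w; rw [cumulantSeries_zero, ha]; rfl
    simp only [hβ, MultSeries.concat, _root_.sum_apply, MultSeries.mulAt_apply]
    simp [MultSeries.ident, h0]
  have hones : MultSeries.compAlong (Composition.ones n)
      (E.tTransform a (Composition.ones n).length) β = E.tTransform a n := by
    ext b
    rw [MultSeries.compAlong_apply]
    have hh : ∀ (k : ℕ) (hk : k = n) (v : Fin k → B) (_ : ∀ i, v i = b (Fin.cast hk i)),
        E.tTransform a k v = E.tTransform a n b := by
      rintro k rfl v hv
      congr 1
      funext i
      exact hv i
    refine hh _ (Composition.ones_length n) _ fun i => ?_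
    rw [hβ1 _ (Composition.ones_blocksFun n i) _
      ⟨0, by rw [Composition.ones_blocksFun]; exact one_pos⟩, Function.comp_apply]
    congr 1
    exact Composition.ones_embedding i _
  rw [MultSeries.comp, ← Finset.add_sum_erase _ _ (Finset.mem_univ (Composition.ones n)), hones,
    tTransform, ← Finset.add_sum_erase _ _ (Finset.mem_univ (Composition.ones n)),
    dif_neg (by simp), zero_add]
  refine (sub_add_cancel _ _).symm.trans (congrArg _ (Finset.sum_congr rfl fun c hc => ?_))
  rw [dif_pos]
  exact lt_of_le_of_ne c.length_le
    (fun h => (Finset.mem_erase.1 hc).1 (Composition.eq_ones_iff_length.2 h))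

/-- The subalgebra of `A` generated by `B` and `a`. -/
def algGen (a : A) : Subalgebra ℂ A :=
  Algebra.adjoin ℂ (Set.range E.incl ∪ {a})

/-- Freeness (over `B`) of two random variables `a` and `b`: `φ (x₁ ⋯ xₘ) = 0` for all
`m ≥ 1` whenever `φ (xⱼ) = 0` for all `j` and the `xⱼ` lie alternatingly in the algebra generated
by `B` and `a` and in the algebra generated by `B` and `b`. -/
def AreFree (a b : A) : Prop :=
  ∀ (m : ℕ) (ε : Fin (m + 1) → Fin 2) (x : Fin (m + 1) → A),
    (∀ j : Fin m, ε j.castSucc ≠ ε j.succ) →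
    (∀ j, x j ∈ E.algGen (![a, b] (ε j))) →
    (∀ j, E.φ (x j) = 0) →
    E.φ (List.ofFn x).prod = 0

end OpValuedSpace

/-! Multilinear function series are treated as functions on words (`Ser`) through the injective map
`ofMult`, which turns concatenation into the product of a ring and `×` into `comp`. The composition
is recursive in the first letter of the word, so its laws are proved by taking left derivatives.

The combinatorics enters once. Splitting a non-crossing partition along the block of its first
element gives `M = C × (I · M)` for the moment series `M` and the cumulant series `C` (`momSer_eq`).
Substituting `a W`, with `W` a `B`-valued series without constant term, one finds that `g = φ((1 - a
W)⁻¹)` solves `g = 1 + (K_a × (W g)) · W g` (`φSer_resolvent`), and the solution is unique degree by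
degree. Thus `K_a`, hence `T_a`, can be read off from expectations of resolvents.

Let `q = T_b`, `ρ = q I q⁻¹`, `p = T_a × ρ`; the claim is `T_ab = p q`. Put `h = 1 + ρ` and `η = 1 -
h⁻¹`. The defining relations yield `K_a × (ρ p⁻¹) = p` and `K_b × (I q⁻¹) = q`, and by the resolvent
equation `x = p⁻¹ a` and `y = b q⁻¹` satisfy `φ((1 - x η)⁻¹) = h = φ((1 - y η)⁻¹)`. With `U`, `V`
these two resolvents, `X = (1 - η) U x - 1` and `Y = V y (1 - η) - 1` are centred, and so is `y' =
(1 - η) Y η h`. Pure algebra (`one_sub_mul_resolvent_product`) gives `(1 - x y η)⁻¹ = h (1 + y') (1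
- X y')⁻¹ (1 + X η)`. Expanding the middle inverse produces alternating products of centred
elements, so by freeness everything to the right of `h` has expectation 1 (`φSer_free_resolvent`),
and `φ((1 - x y η)⁻¹) = h`. Conjugating by `p`, this becomes the resolvent of `a b` at `q⁻¹ η p⁻¹`,
whose equation forces `K_ab × (I (p q)⁻¹) = p q`. By the defining relation of the `T`-transform this
means `T_ab = p q`. -/

/-! ### Series on words: derivatives, convolution and the ring structure. -/

/-- Formal power series in non-commuting variables indexed by `V`, with coefficients in `A`. -/
@[ext] structure Ser (V A : Type*) where
  /-- the coefficient of a word -/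
  coeff : List V → A

namespace Ser

variable {V W X A : Type*}

instance : CoeFun (Ser V A) fun _ => List V → A := ⟨coeff⟩

theorem ext' {f g : Ser V A} (h : ∀ l, f l = g l) : f = g := Ser.ext (funext h)

/-- The left derivative of a series: `der x f l = f (x :: l)`. -/
def der (x : V) (f : Ser V A) : Ser V A := ⟨fun l => f (x :: l)⟩

@[simp] theorem der_apply (x : V) (f : Ser V A) (l : List V) : der x f l = f (x :: l) := rfl

/-- Apply a function to each coefficient. -/
def map {C : Type*} (g : A → C) (f : Ser V A) : Ser V C := ⟨fun l => g (f l)⟩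

@[simp] theorem map_apply {C : Type*} (g : A → C) (f : Ser V A) (l : List V) :
    map g f l = g (f l) := rfl

/-- Substitute `g y` for each letter `y`. -/
def comap {Y : Type*} (g : Y → V) (f : Ser V A) : Ser Y A := ⟨fun l => f (l.map g)⟩

@[simp] theorem comap_apply {Y : Type*} (g : Y → V) (f : Ser V A) (l : List Y) :
    comap g f l = f (l.map g) := rfl

section AddCommGroup
variable [AddCommGroup A]

instance : Zero (Ser V A) := ⟨⟨fun _ => 0⟩⟩
instance : Add (Ser V A) := ⟨fun f g => ⟨fun l => f l + g l⟩⟩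
instance : Neg (Ser V A) := ⟨fun f => ⟨fun l => -f l⟩⟩
instance : Sub (Ser V A) := ⟨fun f g => ⟨fun l => f l - g l⟩⟩

@[simp] theorem zero_apply (l : List V) : (0 : Ser V A) l = 0 := rfl
@[simp] theorem add_apply (f g : Ser V A) (l : List V) : (f + g) l = f l + g l := rfl
@[simp] theorem neg_apply (f : Ser V A) (l : List V) : (-f) l = -f l := rfl
@[simp] theorem sub_apply (f g : Ser V A) (l : List V) : (f - g) l = f l - g l := rfl

instance : AddCommGroup (Ser V A) where
  add_assoc f g h := by ext l; simp [add_assoc]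
  zero_add f := by ext l; simp
  add_zero f := by ext l; simp
  nsmul := nsmulRec
  zsmul := zsmulRec
  neg_add_cancel f := by ext l; simp
  add_comm f g := by ext l; simp [add_comm]
  sub_eq_add_neg f g := by ext l; simp [sub_eq_add_neg]

/-- The series `l ↦ ∑ f (δ l₁) l₂`, the sum being over all splittings `l = l₁ ++ l₂`. -/
def bind (δ : Ser V X) (f : X → Ser V A) : Ser V A :=
  ⟨fun l => ∑ i ∈ range (l.length + 1), f (δ (l.take i)) (l.drop i)⟩

theorem bind_apply (δ : Ser V X) (f : X → Ser V A) (l : List V) :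
    bind δ f l = ∑ i ∈ range (l.length + 1), f (δ (l.take i)) (l.drop i) := rfl

@[simp] theorem bind_nil (δ : Ser V X) (f : X → Ser V A) : bind δ f [] = f (δ []) [] := by
  simp [bind_apply]

theorem bind_cons (δ : Ser V X) (f : X → Ser V A) (b : V) (l : List V) :
    bind δ f (b :: l) = f (δ []) (b :: l) + bind (der b δ) f l := by
  rw [bind_apply, List.length_cons, Finset.sum_range_succ', add_comm]
  rfl

theorem der_bind (δ : Ser V X) (f : X → Ser V A) (b : V) :
    der b (bind δ f) = der b (f (δ [])) + bind (der b δ) f := by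
  ext l; exact bind_cons _ _ _ _

theorem bind_congr {δ δ' : Ser V X} {f f' : X → Ser V A} {l : List V}
    (h : ∀ i ≤ l.length, f (δ (l.take i)) (l.drop i) = f' (δ' (l.take i)) (l.drop i)) :
    bind δ f l = bind δ' f' l :=
  Finset.sum_congr rfl fun i hi => h i (Nat.lt_succ_iff.1 (Finset.mem_range.1 hi))

theorem bind_add_right (δ : Ser V X) (f g : X → Ser V A) :
    bind δ (fun x => f x + g x) = bind δ f + bind δ g := by
  ext l; simp [bind_apply, Finset.sum_add_distrib]

theorem bind_add_left [AddCommGroup X] {f : X → Ser V A} (hf : ∀ x y, f (x + y) = f x + f y)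
    (δ δ' : Ser V X) : bind (δ + δ') f = bind δ f + bind δ' f := by
  ext l; simp [bind_apply, hf, Finset.sum_add_distrib]

/-- Both sides sum over the splittings of a word into three pieces. Associativity of the product and
of the composition both rest on this. The sum inside `bind δ f` has to be pulled through `g`, whence
the additivity. -/
theorem bind_bind [AddCommGroup X] {Y : Type*} (δ : Ser V Y) (f : Y → Ser V X)
    {g : X → Ser V A} (hg : ∀ x y, g (x + y) = g x + g y) :
    bind (bind δ f) g = bind δ fun y => bind (f y) g := by
  ext l
  induction l generalizing δ with
  | nil => simp
  | cons b l ih =>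
    rw [bind_cons, bind_cons, bind_nil, der_bind, bind_add_left hg, bind_cons, ← ih, add_apply,
      add_assoc]

end AddCommGroup

section Ring
variable [Ring A]

instance : One (Ser V A) := ⟨⟨fun l => match l with | [] => 1 | _ :: _ => 0⟩⟩

@[simp] theorem one_nil : (1 : Ser V A) [] = 1 := rfl
@[simp] theorem one_cons (b : V) (l : List V) : (1 : Ser V A) (b :: l) = 0 := rfl

/-- Multiplication of the coefficients by `x` from the left. -/
def scale (x : A) (f : Ser V A) : Ser V A := ⟨fun l => x * f l⟩

@[simp] theorem scale_apply (x : A) (f : Ser V A) (l : List V) : scale x f l = x * f l := rfl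

theorem add_scale (x y : A) (f : Ser V A) : scale (x + y) f = scale x f + scale y f := by
  ext l; simp [add_mul]

instance : Mul (Ser V A) := ⟨fun f g => bind f fun x => scale x g⟩

theorem mul_def (f g : Ser V A) : f * g = bind f fun x => scale x g := rfl

theorem mul_apply (f g : Ser V A) (l : List V) :
    (f * g) l = ∑ i ∈ range (l.length + 1), f (l.take i) * g (l.drop i) := rfl

@[simp] theorem mul_nil (f g : Ser V A) : (f * g) [] = f [] * g [] := by
  simp [mul_def]

theorem mul_cons (f g : Ser V A) (b : V) (l : List V) :
    (f * g) (b :: l) = f [] * g (b :: l) + (der b f * g) l := bind_cons _ _ _ _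

protected theorem zero_mul (f : Ser V A) : 0 * f = 0 := by ext l; simp [mul_apply]

@[simp] theorem der_one (b : V) : der b (1 : Ser V A) = 0 := rfl

protected theorem one_mul (f : Ser V A) : 1 * f = f := by
  ext l
  cases l with
  | nil => simp
  | cons b l => rw [mul_cons, der_one, Ser.zero_mul]; simp

protected theorem mul_one (f : Ser V A) : f * 1 = f := by
  ext l
  induction l generalizing f with
  | nil => simp
  | cons b l ih => rw [mul_cons, ih]; simp

theorem scale_mul (x : A) (f g : Ser V A) : scale x f * g = scale x (f * g) := by
  ext l; simp [mul_apply, Finset.mul_sum, mul_assoc]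

instance : Ring (Ser V A) where
  __ := (inferInstance : AddCommGroup (Ser V A))
  left_distrib f g h := by ext l; simp [mul_apply, mul_add, Finset.sum_add_distrib]
  right_distrib f g h := by ext l; simp [mul_apply, add_mul, Finset.sum_add_distrib]
  zero_mul := Ser.zero_mul
  mul_zero f := by ext l; simp [mul_apply]
  mul_assoc f g h := by
    have := bind_bind f (fun x => scale x g) (g := fun x => scale x h) fun x y => add_scale x y h
    refine this.trans ?_
    rw [mul_def f]
    congr 1
    funext x
    exact scale_mul x g h
  one_mul := Ser.one_mul
  mul_one := Ser.mul_one

/-- The ring homomorphism `map g`. -/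
def mapHom {C : Type*} [Ring C] (g : A →+* C) : Ser V A →+* Ser V C where
  toFun := map g
  map_one' := by ext l; cases l <;> simp
  map_mul' f h := by ext l; simp [mul_apply]
  map_zero' := by ext l; simp
  map_add' f h := by ext l; simp

@[simp] theorem mapHom_apply {C : Type*} [Ring C] (g : A →+* C) (f : Ser V A) (l : List V) :
    mapHom g f l = g (f l) := rfl

end Ring

/-! ### Composition -/

/-- The coefficients of `comp`. -/
def compCoeff [AddCommGroup A] (β : Ser V X) : List V → Ser X A → A
  | [], α => α []
  | b :: l, α => ∑ i ∈ range (l.length + 1), compCoeff β (l.drop i) (der (β (b :: l.take i)) α)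
termination_by l => l.length
decreasing_by simp

/-- The composition `α × β`; the constant term of `β` plays no role. -/
def comp [AddCommGroup A] (α : Ser X A) (β : Ser V X) : Ser V A := ⟨fun l => compCoeff β l α⟩

section Comp
variable [AddCommGroup A]

@[simp] theorem comp_nil (α : Ser X A) (β : Ser V X) : comp α β [] = α [] := by
  change compCoeff β [] α = _
  rw [compCoeff]

/-- Chain rule: the first inner block begins with `b`, and its value becomes the first argument of
`α`. Only values of `β` on nonempty words occur. -/
theorem der_comp (α : Ser X A) (β : Ser V X) (b : V) :
    der b (comp α β) = bind (der b β) fun x => comp (der x α) β := by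
  ext l
  change compCoeff β (b :: l) α = _
  rw [compCoeff]
  rfl

theorem comp_cons (α : Ser X A) (β : Ser V X) (b : V) (l : List V) :
    comp α β (b :: l) = bind (der b β) (fun x => comp (der x α) β) l := by
  rw [← der_comp, der_apply]

/-- To prove a statement about words it is enough to prove it for the empty word and for `b :: l`,
given that it holds for all words not longer than `l`. -/
theorem _root_.List.length_induction {P : List V → Prop} (nil : P [])
    (cons : ∀ b l, (∀ l' : List V, l'.length ≤ l.length → P l') → P (b :: l)) (l : List V) :
    P l := by
  induction hn : l.length using Nat.strong_induction_on generalizing l with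
  | _ n ih =>
    cases l with
    | nil => exact nil
    | cons b l =>
      exact cons b l fun l' h => ih l'.length (by rw [← hn, List.length_cons]; omega) l' rfl

/-- A series that is additive in each argument. -/
def MultiAdd [Add X] (α : Ser X A) : Prop :=
  ∀ (l : List X) (x y : X) (l' : List X),
    α (l ++ (x + y) :: l') = α (l ++ x :: l') + α (l ++ y :: l')

theorem MultiAdd.der [Add X] {α : Ser X A} (h : MultiAdd α) (x : X) : MultiAdd (der x α) :=
  fun l => h (x :: l)

theorem MultiAdd.der_add [Add X] {α : Ser X A} (h : MultiAdd α) (x y : X) :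
    Ser.der (x + y) α = Ser.der x α + Ser.der y α := by
  ext l; exact h [] x y l

theorem MultiAdd.der_zero [AddCommGroup X] {α : Ser X A} (h : MultiAdd α) :
    Ser.der 0 α = 0 := by
  have := h.der_add 0 0
  simpa using this

theorem add_comp (α α' : Ser X A) (β : Ser V X) :
    comp (α + α') β = comp α β + comp α' β := by
  ext l
  induction l using List.length_induction generalizing α α' with
  | nil => simp
  | cons b l ih =>
    rw [add_apply, comp_cons, comp_cons, comp_cons, ← add_apply, ← bind_add_right]
    exact bind_congr fun i hi => ih (l.drop i) (by simp) (der _ α) (der _ α')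

theorem map_comp {C : Type*} [AddCommGroup C] (g : A →+ C) (α : Ser X A) (β : Ser V X) :
    comp (map g α) β = map g (comp α β) := by
  ext l
  induction l using List.length_induction generalizing α with
  | nil => simp
  | cons b l ih =>
    rw [map_apply, comp_cons, comp_cons, bind_apply, bind_apply, map_sum]
    exact Finset.sum_congr rfl fun i hi => ih (l.drop i) (by simp) (der _ α)

theorem comap_comp {Y : Type*} (g : Y → X) (α : Ser X A) (β : Ser V Y) :
    comp (comap g α) β = comp α (map g β) := by
  ext l
  induction l using List.length_induction generalizing α with
  | nil => simp
  | cons b l ih =>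
    rw [comp_cons, comp_cons, bind_apply, bind_apply]
    exact Finset.sum_congr rfl fun i hi => ih (l.drop i) (by simp) (der _ α)

/-- A cut of the outer word falls between two inner blocks, so `γ` can be substituted on both sides
of the cut separately. Multiplicativity of the composition is the special case of `scale`. -/
theorem bind_comp {Y : Type*} [AddCommGroup Y] (δ : Ser W Y) {f : Y → Ser W A}
    (hf : ∀ x y, f (x + y) = f x + f y) (γ : Ser V W) :
    comp (bind δ f) γ = bind (comp δ γ) fun y => comp (f y) γ := by
  ext l
  induction l using List.length_induction generalizing δ with
  | nil => simp
  | cons b l ih =>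
    have hfc : ∀ x y, comp (f (x + y)) γ = comp (f x) γ + comp (f y) γ := fun x y => by
      rw [hf, add_comp]
    have h1 : comp (bind δ f) γ (b :: l) = bind (der b γ) (fun x =>
        comp (der x (f (δ []))) γ + bind (comp (der x δ) γ) fun y => comp (f y) γ) l := by
      rw [comp_cons]
      refine bind_congr fun i hi => ?_
      rw [der_bind, add_comp, add_apply, add_apply]
      congr 1
      exact ih (l.drop i) (by simp) _
    rw [h1, bind_cons, der_comp, bind_add_right, add_apply, bind_bind _ _ hfc, comp_cons,
      comp_nil]

/-- After a derivative in the first letter both sides are iterated `bind`s, matched by `bind_bind`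
and `bind_comp`. On the right the letters fed to `α` are sums of values of `β`, so `α` must be
additive in each argument; `β` and `γ` are arbitrary. -/
theorem comp_assoc [AddCommGroup X] {Y : Type*} {α : Ser X A} (hα : MultiAdd α)
    (β : Ser Y X) (γ : Ser V Y) :
    comp (comp α β) γ = comp α (comp β γ) := by
  ext l
  induction l using List.length_induction generalizing α with
  | nil => simp
  | cons b l ih =>
    have hadd : ∀ x y, comp (der (x + y) α) β = comp (der x α) β + comp (der y α) β :=
      fun x y => by rw [hα.der_add, add_comp]
    have hadd' : ∀ x y, comp (der (x + y) α) (comp β γ) =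
        comp (der x α) (comp β γ) + comp (der y α) (comp β γ) :=
      fun x y => by rw [hα.der_add, add_comp]
    rw [comp_cons, comp_cons, der_comp, bind_bind _ _ hadd']
    refine bind_congr fun i hi => ?_
    rw [der_comp, bind_comp _ hadd]
    refine bind_congr fun j hj => ?_
    exact ih _ (by simp) (hα.der _)

end Comp

section CompRing
variable [Ring A]

@[simp] theorem zero_comp {A : Type*} [AddCommGroup A] (β : Ser V X) :
    comp (0 : Ser X A) β = 0 := by
  have h := add_comp (0 : Ser X A) 0 β
  simpa using h

@[simp] theorem one_comp (β : Ser V X) : comp (1 : Ser X A) β = 1 := by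
  ext l
  cases l with
  | nil => simp
  | cons b l => simp [comp_cons, bind_apply]

theorem scale_comp (x : A) (α : Ser X A) (β : Ser V X) :
    comp (scale x α) β = scale x (comp α β) :=
  map_comp (AddMonoidHom.mulLeft x) α β

theorem mul_comp (α α' : Ser W A) (γ : Ser V W) :
    comp (α * α') γ = comp α γ * comp α' γ := by
  rw [mul_def, bind_comp _ fun x y => add_scale x y α', mul_def]
  congr 1
  funext x
  exact scale_comp _ _ _

/-- The series of the map `g`, with only words of length one. -/
def lin (g : V → A) : Ser V A := ⟨fun l => match l with | [x] => g x | _ => 0⟩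

theorem der_lin (g : V → A) (x : V) : der x (lin g) = scale (g x) 1 := by
  ext l
  cases l with
  | nil => simp [lin]
  | cons b l => simp [lin]

@[simp] theorem lin_nil (g : V → A) : lin g [] = 0 := rfl

theorem lin_mul_cons (g : V → A) (f : Ser V A) (x : V) (l : List V) :
    (lin g * f) (x :: l) = g x * f l := by
  rw [mul_cons, der_lin, scale_mul]; simp

/-- `comp` ignores the constant term of `Z` while `map g` keeps it, so it has to be killed by `g`.
-/
theorem lin_comp (g : X → A) {Z : Ser V X} (hZ : g (Z []) = 0) : comp (lin g) Z = map g Z := by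
  ext l
  cases l with
  | nil => simp [hZ]
  | cons b l =>
    rw [comp_cons]
    have : ∀ x, comp (der x (lin g)) Z = scale (g x) 1 := fun x => by
      rw [der_lin, scale_comp, one_comp]
    simp only [this]
    have h2 : bind (der b Z) (fun x => scale (g x) (1 : Ser V A)) = map g (der b Z) * 1 := rfl
    rw [h2, mul_one]; rfl

/-- A first block of length at least two feeds 0 to `α`, which vanishes there by additivity; only
blocks of length one survive. -/
theorem comp_lin_id {α : Ser A A} (hα : MultiAdd α) : comp α (lin id : Ser A A) = α := by
  ext l
  induction l generalizing α with
  | nil => simp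
  | cons b l ih =>
    rw [comp_cons, der_lin, bind_apply, Finset.sum_eq_single 0]
    · simpa using ih (hα.der b)
    · intro i hi hi0
      cases l with
      | nil => simp at hi; omega
      | cons c l =>
        obtain ⟨k, rfl⟩ := Nat.exists_eq_succ_of_ne_zero hi0
        simp [hα.der_zero]
    · simp

end CompRing

/-! ### Agreement up to a degree -/

/-- The coefficients of words of length less than `n` agree. -/
def Agree (n : ℕ) (f g : Ser V A) : Prop := ∀ l : List V, l.length < n → f l = g l

theorem eq_of_agree {f g : Ser V A} (h : ∀ n, Agree n f g) : f = g :=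
  ext' fun l => h (l.length + 1) l (Nat.lt_succ_self _)

theorem Agree.refl (n : ℕ) (f : Ser V A) : Agree n f f := fun _ _ => rfl

theorem Agree.add [AddCommGroup A] {n : ℕ} {f f' g g' : Ser V A} (hf : Agree n f f')
    (hg : Agree n g g') : Agree n (f + g) (f' + g') := fun l hl => by
  rw [add_apply, add_apply, hf l hl, hg l hl]

theorem Agree.mul [Ring A] {n : ℕ} {f f' g g' : Ser V A} (hf : Agree n f f')
    (hg : Agree n g g') : Agree n (f * g) (f' * g') := fun l hl => by
  rw [mul_apply, mul_apply]
  refine Finset.sum_congr rfl fun i _ => ?_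
  rw [hf _ (by simp; omega), hg _ (by simp; omega)]

/-- A factor without constant term consumes at least one letter. This gain of one degree makes the
fixed-point maps below contractions. -/
theorem Agree.mul_left [Ring A] {n : ℕ} {w g g' : Ser V A} (hw : w [] = 0)
    (hg : Agree n g g') : Agree (n + 1) (w * g) (w * g') := fun l hl => by
  cases l with
  | nil => simp [hw]
  | cons b l =>
    rw [mul_cons, mul_cons, hw, zero_mul, zero_mul]
    congr 1
    exact (Agree.refl n _).mul hg l (by simpa using hl)

theorem Agree.comp_right [AddCommGroup A] {n : ℕ} (α : Ser X A) {β β' : Ser V X} (h : Agree n β β') :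
    Agree n (comp α β) (comp α β') := fun l hl => by
  induction l using List.length_induction generalizing α with
  | nil => simp
  | cons b l ih =>
    rw [comp_cons, comp_cons]
    simp only [List.length_cons] at hl
    refine bind_congr fun i hi => ?_
    rw [der_apply, der_apply, h _ (by simp; omega)]
    exact ih _ (by simp) _ (by simp; omega)

theorem eq_of_contraction {F : Ser V A → Ser V A}
    (hF : ∀ n f g, Agree n f g → Agree (n + 1) (F f) (F g)) {f g : Ser V A}
    (hf : f = F f) (hg : g = F g) : f = g := by
  refine eq_of_agree fun n => ?_
  induction n with
  | zero => exact fun l hl => absurd hl (Nat.not_lt_zero _)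
  | succ n ih =>
    have := hF n f g ih
    rwa [← hf, ← hg] at this

/-! ### Inverses -/

section Inverse
variable [Ring A]

/-- The series `l ↦ l.prod`. -/
def prod : Ser A A := ⟨List.prod⟩

@[simp] theorem prod_apply (l : List A) : (prod : Ser A A) l = l.prod := rfl

theorem prod_eq : (prod : Ser A A) = 1 + lin id * prod := by
  ext l
  cases l with
  | nil => simp
  | cons x l => rw [add_apply, lin_mul_cons]; simp

/-- `prod` is the non-commutative geometric series, so `comp prod w` is `(1 - w)⁻¹`. Writing the
inverse as a composition lets a coefficientwise map such as `φ` act on `prod` alone. -/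
theorem prod_comp_eq {w : Ser V A} (hw : w [] = 0) :
    comp prod w = 1 + w * comp prod w := by
  conv_lhs => rw [prod_eq]
  rw [add_comp, one_comp, mul_comp, lin_comp id hw]
  rfl

theorem one_sub_mul_prod_comp {w : Ser V A} (hw : w [] = 0) :
    (1 - w) * comp prod w = 1 := by
  rw [sub_mul, one_mul, sub_eq_iff_eq_add]; exact prod_comp_eq hw

/-- The geometric series is a right inverse with constant term 1, so it has a right inverse itself,
which must be `f`. -/
theorem exists_inverse {f : Ser V A} (hf : f [] = 1) : ∃ g, f * g = 1 ∧ g * f = 1 ∧ g [] = 1 := by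
  have key : ∀ f : Ser V A, f [] = 1 → ∃ g : Ser V A, f * g = 1 ∧ g [] = 1 := fun f hf => by
    refine ⟨comp prod (1 - f), ?_, by simp⟩
    have := one_sub_mul_prod_comp (w := 1 - f) (by simp [hf])
    rwa [sub_sub_cancel] at this
  obtain ⟨g, hg, hg0⟩ := key f hf
  obtain ⟨k, hk, -⟩ := key g hg0
  refine ⟨g, hg, ?_, hg0⟩
  have : f = k := by rw [← mul_one f, ← hk, ← mul_assoc, hg, one_mul]
  rwa [this]

theorem prod_comp_mul_one_sub {w : Ser V A} (hw : w [] = 0) :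
    comp prod w * (1 - w) = 1 := by
  obtain ⟨g, h1, h2, -⟩ := exists_inverse (f := 1 - w) (by simp [hw])
  rwa [← left_inv_eq_right_inv h2 (one_sub_mul_prod_comp hw)] at *

theorem mul_lin_concat (f : Ser V A) (g : V → A) (l : List V) (x : V) :
    (f * lin g) (l ++ [x]) = f l * g x := by
  induction l generalizing f with
  | nil => simp [mul_cons, lin]
  | cons b l ih =>
    rw [List.cons_append, mul_cons, ih]
    cases l <;> simp [lin]

/-- On words ending in the letter 1 the right factor `lin id` reads just that letter and drops out.
-/
theorem mul_lin_id_cancel {f g : Ser A A} (h : f * lin id = g * lin id) : f = g := by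
  ext l
  have := congrArg (fun k : Ser A A => k (l ++ [1])) h
  simpa only [mul_lin_concat, id, mul_one] using this

end Inverse

end Ser

/-! ### Translation of multilinear function series into series on words. -/

/-- Splitting off the first part reproduces the recursion of `Ser.comp`, which reads the first
block. -/
theorem Composition.sum_succ {M : Type*} [AddCommMonoid M] (n : ℕ) (Φ : List ℕ → M) :
    ∑ c : Composition (n + 1), Φ c.blocks =
      ∑ i ∈ range (n + 1), ∑ c : Composition (n - i), Φ ((i + 1) :: c.blocks) := by
  rw [Finset.sum_sigma']
  symm
  refine Finset.sum_bij (fun x hx => ⟨(x.1 + 1) :: x.2.blocks, ?_, ?_⟩) ?_ ?_ ?_ ?_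
  · intro i hi
    rcases List.mem_cons.1 hi with rfl | hi
    · exact Nat.succ_pos _
    · exact x.2.blocks_pos hi
  · have := Finset.mem_range.1 (Finset.mem_sigma.1 hx).1
    rw [List.sum_cons, x.2.blocks_sum]
    omega
  · intro x hx; exact Finset.mem_univ _
  · rintro ⟨i, c⟩ hx ⟨j, d⟩ hy h
    have h' := congrArg Composition.blocks h
    simp only [List.cons.injEq, Nat.add_right_cancel_iff] at h'
    obtain ⟨rfl, h2⟩ := h'
    rw [Composition.ext h2]
  · intro c _
    rcases hc : c.blocks with _ | ⟨k, bs⟩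
    · have := c.blocks_sum
      simp [hc] at this
    · have hk : 0 < k := c.blocks_pos (by rw [hc]; exact List.mem_cons_self)
      have hs := c.blocks_sum
      rw [hc, List.sum_cons] at hs
      refine ⟨⟨k - 1, ⟨bs, fun {i} hi => c.blocks_pos (by rw [hc]; exact List.mem_cons_of_mem _ hi),
        by omega⟩⟩, ?_, ?_⟩
      · simp; omega
      · refine Composition.ext ?_
        simp only [hc, List.cons.injEq, and_true]
        omega
  · intro x hx; rfl

namespace Ser

variable {V X A : Type*} [AddCommGroup A]

theorem sum_composition_eq_comp (F : Ser X A) (G : Ser V X) (l : List V) {n : ℕ}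
    (hn : n = l.length) :
    ∑ c : Composition n, F ((l.splitWrtCompositionAux c.blocks).map G) = comp F G l := by
  induction l using List.length_induction generalizing F n with
  | nil =>
    subst hn
    have : ∀ c : Composition ([] : List V).length, c.blocks = [] := fun c => by
      have := c.length_le
      exact List.length_eq_zero_iff.1 (Nat.le_zero.1 this)
    simp only [this, comp_nil]
    rw [Finset.sum_const, Finset.card_univ, composition_card]
    simp [List.splitWrtCompositionAux]
  | cons b l ih =>
    subst hn
    refine (Composition.sum_succ l.length
      fun bs => F (((b :: l).splitWrtCompositionAux bs).map G)).trans ?_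
    rw [comp_cons, bind_apply]
    refine Finset.sum_congr rfl fun i hi => ?_
    have := ih (l.drop i) (by simp) (der (der b G (l.take i)) F) (n := l.length - i) (by simp)
    rw [← this]
    refine Finset.sum_congr rfl fun c _ => ?_
    simp [List.splitWrtCompositionAux_cons]

section MultSeries

variable {R : Type*} [CommRing R] {M N : Type*} [AddCommGroup M] [Module R M] [AddCommGroup N]
  [Module R N]

/-- The series of a sequence of multilinear maps. -/
def ofMult (α : ∀ n : ℕ, MultilinearMap R (fun _ : Fin n => M) N) : Ser M N :=
  ⟨fun l => α l.length l.get⟩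

theorem ofMult_eq (α : ∀ n : ℕ, MultilinearMap R (fun _ : Fin n => M) N) {l : List M} {n : ℕ}
    (hn : l.length = n) {v : Fin n → M} (hv : ∀ i (hi : i < n), l[i] = v ⟨i, hi⟩) :
    ofMult α l = α n v := by
  subst hn
  change α _ _ = _
  congr 1
  funext i
  exact hv i i.2

theorem ofMult_ofFn (α : ∀ n : ℕ, MultilinearMap R (fun _ : Fin n => M) N) {n : ℕ}
    (v : Fin n → M) : ofMult α (List.ofFn v) = α n v :=
  ofMult_eq α (List.length_ofFn) fun i hi => by simp

theorem ofMult_injective :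
    Function.Injective (ofMult : (∀ n : ℕ, MultilinearMap R (fun _ : Fin n => M) N) → Ser M N) := by
  intro α β h
  funext n
  ext v
  rw [← ofMult_ofFn, h, ofMult_ofFn]

theorem multiAdd_ofMult (α : ∀ n : ℕ, MultilinearMap R (fun _ : Fin n => M) N) :
    MultiAdd (ofMult α) := by
  intro l x y l'
  have key : ∀ z, ofMult α (l ++ z :: l') = α (l ++ x :: l').length
      (Function.update (l ++ x :: l').get ⟨l.length, by simp⟩ z) := fun z => by
    refine ofMult_eq α (by simp) fun i hi => ?_
    by_cases h : i = l.length
    · subst h; simp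
    · rw [Function.update_of_ne (by simpa [Fin.ext_iff] using h)]
      rcases lt_or_gt_of_ne h with h | h
      · simp [List.getElem_append_left h]
      · obtain ⟨k, rfl⟩ := Nat.exists_eq_add_of_lt h
        simp [List.getElem_append_right, Nat.add_assoc]
  rw [key, key x, key y, MultilinearMap.map_update_add]

end MultSeries

section

variable {B : Type*} [Ring B] [Algebra ℂ B]

theorem ofMult_concat (α β : MultSeries B) :
    ofMult (MultSeries.concat α β) = ofMult α * ofMult β := by
  ext l
  rw [mul_apply, Finset.sum_range]
  change (∑ k : Fin (l.length + 1), _ : MultilinearMap ℂ (fun _ : Fin l.length => B) B) l.get = _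
  rw [_root_.sum_apply]
  refine Finset.sum_congr rfl fun k _ => ?_
  rw [MultSeries.mulAt_apply]
  congr 1
  · symm
    exact ofMult_eq α (by simp; omega) fun i hi => by simp
  · symm
    exact ofMult_eq β (by simp) fun i hi => by simp

theorem ofMult_one : ofMult (MultSeries.one : MultSeries B) = 1 := by
  ext l
  cases l <;> rfl

theorem ofMult_ident : ofMult (MultSeries.ident : MultSeries B) = lin id := by
  ext l
  rcases l with _ | ⟨b, _ | ⟨c, l⟩⟩ <;> rfl

theorem ofMult_comp (α β : MultSeries B) :
    ofMult (MultSeries.comp α β) = comp (ofMult α) (ofMult β) := by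
  ext l
  rw [← sum_composition_eq_comp _ _ l rfl]
  change (∑ c : Composition l.length, _ : MultilinearMap ℂ (fun _ : Fin l.length => B) B) l.get = _
  rw [_root_.sum_apply]
  refine Finset.sum_congr rfl fun c _ => ?_
  rw [MultSeries.compAlong_apply]
  symm
  change ofMult α ((l.splitWrtComposition c).map _) = _
  refine ofMult_eq α (by simp) fun i hi => ?_
  rw [List.getElem_map, List.getElem_splitWrtComposition]
  refine ofMult_eq β ?_ fun j hj => ?_
  · have h1 := c.sizeUpTo_succ hi
    have h2 := c.sizeUpTo_le (i + 1)
    simp only [List.length_drop, List.length_take, Composition.blocksFun, List.get_eq_getElem]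
    omega
  · simp [Composition.embedding]

end

end Ser

/-! ### Non-crossing partitions as relations on `ℕ`, cut at the successor of the first element. -/

namespace Finpartition

variable {n : ℕ}

theorem ext_part {α : Type*} [DecidableEq α] {s : Finset α} {π π' : Finpartition s}
    (h : ∀ u ∈ s, ∀ v ∈ s, π.part u = π.part v ↔ π'.part u = π'.part v) : π = π' := by
  have hp : ∀ u ∈ s, π.part u = π'.part u := fun u hu => by
    ext v
    by_cases hv : v ∈ s
    · rw [π.mem_part_iff_part_eq_part hv hu, π'.mem_part_iff_part_eq_part hv hu, h _ hv _ hu]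
    · exact iff_of_false (fun h => hv (π.part_subset _ h)) (fun h => hv (π'.part_subset _ h))
  have key : ∀ {π π' : Finpartition s}, (∀ u ∈ s, π.part u = π'.part u) → π.parts ⊆ π'.parts :=
    fun {π π'} hp p hp' => by
      obtain ⟨x, hx⟩ := π.nonempty_of_mem_parts hp'
      have hxs := π.le hp' hx
      rw [← π.part_eq_of_mem hp' hx, hp x hxs]
      exact π'.part_mem.2 hxs
  exact Finpartition.ext ((key hp).antisymm (key fun u hu => (hp u hu).symm))

/-- The equivalence relation of a partition of `{0, …, n - 1}`, extended trivially to `ℕ`. -/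
def rel (π : Finpartition (univ : Finset (Fin n))) (u v : ℕ) : Prop :=
  u = v ∨ ∃ (hu : u < n) (hv : v < n), π.part ⟨u, hu⟩ = π.part ⟨v, hv⟩

theorem rel_fin (π : Finpartition (univ : Finset (Fin n))) (u v : Fin n) :
    π.rel u v ↔ π.part u = π.part v := by
  constructor
  · rintro (h | ⟨_, _, h⟩)
    · rw [Fin.ext h]
    · exact h
  · exact fun h => Or.inr ⟨u.2, v.2, h⟩

theorem equivalence_rel (π : Finpartition (univ : Finset (Fin n))) : Equivalence π.rel where
  refl u := Or.inl rfl
  symm := by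
    rintro u v (h | ⟨hu, hv, h⟩)
    · exact Or.inl h.symm
    · exact Or.inr ⟨hv, hu, h.symm⟩
  trans := by
    rintro u v w (rfl | ⟨hu, hv, h⟩) (rfl | ⟨hv', hw, h'⟩)
    · exact Or.inl rfl
    · exact Or.inr ⟨hv', hw, h'⟩
    · exact Or.inr ⟨hu, hv, h⟩
    · exact Or.inr ⟨hu, hw, h.trans h'⟩

theorem rel_ext {π π' : Finpartition (univ : Finset (Fin n))}
    (h : ∀ u v, π.rel u v ↔ π'.rel u v) : π = π' :=
  ext_part fun u _ v _ => by rw [← rel_fin, ← rel_fin, h]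

open Classical in
/-- The partition of `{0, …, n - 1}` given by an equivalence relation on `ℕ`. -/
noncomputable def ofRel (n : ℕ) {r : ℕ → ℕ → Prop} (hr : Equivalence r) :
    Finpartition (univ : Finset (Fin n)) :=
  Finpartition.ofSetoid (Setoid.comap (fun u : Fin n => (u : ℕ)) ⟨r, hr⟩)

theorem rel_ofRel {r : ℕ → ℕ → Prop} (hr : Equivalence r)
    (hn : ∀ u v, r u v → u ≠ v → u < n) (u v : ℕ) : (ofRel n hr).rel u v ↔ r u v := by
  classical
  have key : ∀ u v : Fin n, (ofRel n hr).part u = (ofRel n hr).part v ↔ r u v := fun u v => by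
    rw [← mem_part_iff_part_eq_part _ (mem_univ _) (mem_univ _), ofRel,
      mem_part_ofSetoid_iff_rel]
    exact ⟨hr.symm, hr.symm⟩
  constructor
  · rintro (rfl | ⟨hu, hv, h⟩)
    · exact hr.refl _
    · exact (key _ _).1 h
  · intro h
    by_cases huv : u = v
    · exact Or.inl huv
    · exact Or.inr ⟨hn _ _ h huv, hn _ _ (hr.symm h) (Ne.symm huv), (key ⟨u, _⟩ ⟨v, _⟩).2 h⟩

end Finpartition

/-- A non-crossing relation on `ℕ`. -/
def NonCrossingRel (r : ℕ → ℕ → Prop) : Prop :=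
  ∀ i j k l, i < j → j < k → k < l → r i k → r j l → r i j

theorem nonCrossingRel_rel {n : ℕ} {π : Finpartition (univ : Finset (Fin n))} :
    NonCrossingRel π.rel ↔ IsNonCrossing π := by
  constructor
  · intro h i j k l hij hjk hkl
    simp only [← π.rel_fin]
    exact h i j k l hij hjk hkl
  · rintro h i j k l hij hjk hkl (h1 | ⟨hi, hk, h1⟩) (h2 | ⟨hj, hl, h2⟩)
    · omega
    · omega
    · omega
    · exact Or.inr ⟨hi, hj, h ⟨i, hi⟩ ⟨j, hj⟩ ⟨k, hk⟩ ⟨l, hl⟩ hij hjk hkl h1 h2⟩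

/-- The relation `r` lives on the interval `[s, t)`. -/
def SupportedOn (s t : ℕ) (r : ℕ → ℕ → Prop) : Prop :=
  ∀ u v, r u v → u ≠ v → s ≤ u ∧ u < t

/-- The restriction of a relation to `[s, t)`. -/
def restrRel (s t : ℕ) (r : ℕ → ℕ → Prop) (u v : ℕ) : Prop :=
  u = v ∨ (s ≤ u ∧ u < t) ∧ (s ≤ v ∧ v < t) ∧ r u v

/-- Replace `s` by `p`, if `p < t`. -/
def shiftTo (s p t u : ℕ) : ℕ := if u = s ∧ p < t then p else u

/-- The relation on `[s, t)` made of a relation on `(s, p)` and a relation on `[p, t)`, where `s` is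
put in the class of `p` if `p < t`. -/
def glueRel (s p t : ℕ) (r₁ r₂ : ℕ → ℕ → Prop) (u v : ℕ) : Prop :=
  ((s < u ∧ u < p) ∧ (s < v ∧ v < p) ∧ r₁ u v) ∨
    (¬(s < u ∧ u < p) ∧ ¬(s < v ∧ v < p) ∧ r₂ (shiftTo s p t u) (shiftTo s p t v))

section Rel

variable {s p t : ℕ} {r r₁ r₂ : ℕ → ℕ → Prop}

theorem equivalence_restrRel (hr : Equivalence r) : Equivalence (restrRel s t r) where
  refl u := Or.inl rfl
  symm := by
    rintro u v (h | ⟨hu, hv, h⟩)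
    · exact Or.inl h.symm
    · exact Or.inr ⟨hv, hu, hr.symm h⟩
  trans := by
    rintro u v w (rfl | ⟨hu, hv, h⟩) (rfl | ⟨hv', hw, h'⟩)
    · exact Or.inl rfl
    · exact Or.inr ⟨hv', hw, h'⟩
    · exact Or.inr ⟨hu, hv, h⟩
    · exact Or.inr ⟨hu, hw, hr.trans h h'⟩

theorem supportedOn_restrRel : SupportedOn s t (restrRel s t r) := by
  rintro u v (h | ⟨hu, -, -⟩) huv
  · exact absurd h huv
  · exact hu

theorem nonCrossingRel_restrRel (hr : NonCrossingRel r) : NonCrossingRel (restrRel s t r) := by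
  rintro i j k l hij hjk hkl (h1 | ⟨hi, hk, h1⟩) (h2 | ⟨hj, hl, h2⟩)
  · omega
  · omega
  · omega
  · exact Or.inr ⟨hi, hj, hr i j k l hij hjk hkl h1 h2⟩

theorem equivalence_glueRel (h₁ : Equivalence r₁) (h₂ : Equivalence r₂) :
    Equivalence (glueRel s p t r₁ r₂) where
  refl u := by
    by_cases h : s < u ∧ u < p
    · exact Or.inl ⟨h, h, h₁.refl _⟩
    · exact Or.inr ⟨h, h, h₂.refl _⟩
  symm := by
    rintro u v (⟨hu, hv, h⟩ | ⟨hu, hv, h⟩)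
    · exact Or.inl ⟨hv, hu, h₁.symm h⟩
    · exact Or.inr ⟨hv, hu, h₂.symm h⟩
  trans := by
    rintro u v w (⟨hu, hv, h⟩ | ⟨hu, hv, h⟩) (⟨hv', hw, h'⟩ | ⟨hv', hw, h'⟩)
    · exact Or.inl ⟨hu, hw, h₁.trans h h'⟩
    · exact absurd hv hv'
    · exact absurd hv' hv
    · exact Or.inr ⟨hu, hw, h₂.trans h h'⟩

theorem SupportedOn.right (hr : Equivalence r) (h : SupportedOn s t r) {u v : ℕ} (huv : r u v)
    (hne : u ≠ v) : s ≤ v ∧ v < t := h v u (hr.symm huv) hne.symm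

theorem supportedOn_glueRel (hsp : s < p) (hpt : p ≤ t)
    (s₂ : SupportedOn p t r₂) : SupportedOn s t (glueRel s p t r₁ r₂) := by
  rintro u v (⟨hu, hv, h⟩ | ⟨hu, hv, h⟩) huv
  · omega
  · by_cases hne : shiftTo s p t u = shiftTo s p t v
    · unfold shiftTo at hne
      split_ifs at hne <;> omega
    · have := s₂ _ _ h hne
      unfold shiftTo at this
      split_ifs at this <;> omega

theorem nonCrossingRel_glueRel (hsp : s < p)
    (h₂ : Equivalence r₂) (s₂ : SupportedOn p t r₂) (n₁ : NonCrossingRel r₁)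
    (n₂ : NonCrossingRel r₂) : NonCrossingRel (glueRel s p t r₁ r₂) := by
  rintro i j k l hij hjk hkl (⟨hi, hk, h1⟩ | ⟨hi, hk, h1⟩) (⟨hj, hl, h2⟩ | ⟨hj, hl, h2⟩)
  · exact Or.inl ⟨hi, hj, n₁ i j k l hij hjk hkl h1 h2⟩
  · omega
  · omega
  · refine Or.inr ⟨hi, hj, ?_⟩
    -- Outside `(s, p)` the shift keeps the order, except that it may identify `s` with `p`; by the
    -- support condition that can only happen to the pair `i`, `j`.
    have hjs : shiftTo s p t j ≠ shiftTo s p t l := by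
      unfold shiftTo; split_ifs <;> omega
    have hj' := s₂ _ _ h2 hjs
    by_cases his : shiftTo s p t i = shiftTo s p t j
    · rw [his]; exact h₂.refl _
    · have hks : shiftTo s p t i ≠ shiftTo s p t k := by
        unfold shiftTo at his ⊢; split_ifs at his ⊢ <;> omega
      have hi' := s₂ _ _ h1 hks
      refine n₂ _ _ _ _ ?_ ?_ ?_ h1 h2 <;>
      · unfold shiftTo at *; split_ifs at * <;> omega

end Rel

/-- The least element after `s` in the class of `s`, or `t` if there is none before `t`. -/
noncomputable def nextElt (s t : ℕ) (r : ℕ → ℕ → Prop) : ℕ :=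
  sInf {p | s < p ∧ (p = t ∨ r s p)}

section NextElt

variable {s p t : ℕ} {r r₁ r₂ : ℕ → ℕ → Prop}

theorem nextElt_mem (hst : s < t) (r : ℕ → ℕ → Prop) :
    s < nextElt s t r ∧ (nextElt s t r = t ∨ r s (nextElt s t r)) :=
  Nat.sInf_mem (s := {p | s < p ∧ (p = t ∨ r s p)}) ⟨t, hst, Or.inl rfl⟩

theorem nextElt_le (hst : s < t) : nextElt s t r ≤ t := Nat.sInf_le ⟨hst, Or.inl rfl⟩

theorem not_rel_of_lt_nextElt {q : ℕ} (hsq : s < q) (hq : q < nextElt s t r) : ¬ r s q :=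
  fun h => absurd (Nat.sInf_le (s := {p | s < p ∧ (p = t ∨ r s p)}) ⟨hsq, Or.inr h⟩) (not_le.2 hq)

/-- No class joins `(s, p)` to the rest of `[s, t)`: a link to `s` contradicts the choice of `p` as
the next element, and a link to some `v ≥ p` would cross the pair `s`, `p`. -/
theorem glueRel_restrRel (hst : s < t) (hr : Equivalence r) (hn : NonCrossingRel r)
    (hs : SupportedOn s t r) (u v : ℕ) :
    glueRel s (nextElt s t r) t (restrRel (s + 1) (nextElt s t r) r)
      (restrRel (nextElt s t r) t r) u v ↔ r u v := by
  have hp := nextElt_mem hst r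
  have hpt := nextElt_le (r := r) hst
  have hnot := fun q => not_rel_of_lt_nextElt (s := s) (t := t) (r := r) (q := q)
  set p := nextElt s t r
  have hshift : ∀ u, r u (shiftTo s p t u) := fun u => by
    unfold shiftTo
    split_ifs with h
    · rw [h.1]
      exact hp.2.resolve_left h.2.ne
    · exact hr.refl u
  constructor
  · rintro (⟨-, -, rfl | ⟨-, -, h⟩⟩ | ⟨-, -, h | ⟨-, -, h⟩⟩)
    · exact hr.refl u
    · exact h
    · exact hr.trans (hshift u) (by rw [h]; exact hr.symm (hshift v))
    · exact hr.trans (hr.trans (hshift u) h) (hr.symm (hshift v))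
  · intro h
    by_cases huv : u = v
    · subst huv
      exact (equivalence_glueRel (equivalence_restrRel hr) (equivalence_restrRel hr)).refl u
    · have hu := hs _ _ h huv
      have hv := hs.right hr h huv
      have cross : ∀ u v, (s < u ∧ u < p) → (s ≤ v ∧ v < t) → r u v → s < v ∧ v < p := by
        intro u v hu hv h
        by_contra hcon
        rcases hv.1.eq_or_lt with rfl | hsv
        · exact hnot u hu.1 hu.2 (hr.symm h)
        · have hpv : p ≤ v := by omega
          have hsp := hp.2.resolve_left (by omega)
          rcases hpv.eq_or_lt with hpv | hpv
          · exact hnot u hu.1 hu.2 (hr.trans hsp (hr.symm (hpv ▸ h)))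
          · exact hnot u hu.1 hu.2 (hn s u p v hu.1 hu.2 hpv hsp h)
      by_cases hu' : s < u ∧ u < p
      · have hv' := cross u v hu' hv h
        exact Or.inl ⟨hu', hv', Or.inr ⟨⟨hu'.1, hu'.2⟩, ⟨hv'.1, hv'.2⟩, h⟩⟩
      · have hv' : ¬(s < v ∧ v < p) := fun hv' => hu' (cross v u hv' hu (hr.symm h))
        refine Or.inr ⟨hu', hv', Or.inr ⟨?_, ?_,
          hr.trans (hr.trans (hr.symm (hshift u)) h) (hshift v)⟩⟩
        · unfold shiftTo; split_ifs <;> omega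
        · unfold shiftTo; split_ifs <;> omega

theorem nextElt_glueRel (hsp : s < p) (hpt : p ≤ t) (h₂ : Equivalence r₂) :
    nextElt s t (glueRel s p t r₁ r₂) = p := by
  refine le_antisymm (Nat.sInf_le ⟨hsp, ?_⟩) ?_
  · rcases hpt.eq_or_lt with h | h
    · exact Or.inl h
    · refine Or.inr (Or.inr ⟨by omega, by omega, ?_⟩)
      have h1 : shiftTo s p t s = p := if_pos ⟨rfl, h⟩
      have h2 : shiftTo s p t p = p := if_neg (by omega)
      rw [h1, h2]
      exact h₂.refl p
  · obtain ⟨h1, h2⟩ := nextElt_mem (hsp.trans_le hpt) (glueRel s p t r₁ r₂)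
    by_contra hlt
    rcases h2 with h2 | ⟨h2, -, -⟩ | ⟨-, h2, -⟩ <;> omega

theorem restrRel_glueRel_left (h₁ : Equivalence r₁) (s₁ : SupportedOn (s + 1) p r₁) (u v : ℕ) :
    restrRel (s + 1) p (glueRel s p t r₁ r₂) u v ↔ r₁ u v := by
  constructor
  · rintro (rfl | ⟨hu, hv, ⟨-, -, h⟩ | ⟨hu', -, -⟩⟩)
    · exact h₁.refl u
    · exact h
    · omega
  · intro h
    by_cases huv : u = v
    · exact Or.inl huv
    · have hu := s₁ _ _ h huv
      have hv := s₁.right h₁ h huv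
      exact Or.inr ⟨hu, hv, Or.inl ⟨hu, hv, h⟩⟩

theorem restrRel_glueRel_right (hsp : s < p) (h₂ : Equivalence r₂) (s₂ : SupportedOn p t r₂)
    (u v : ℕ) : restrRel p t (glueRel s p t r₁ r₂) u v ↔ r₂ u v := by
  have hid : ∀ u, p ≤ u → shiftTo s p t u = u := fun u hu => if_neg (by omega)
  constructor
  · rintro (rfl | ⟨hu, hv, ⟨hu', -, -⟩ | ⟨-, -, h⟩⟩)
    · exact h₂.refl u
    · omega
    · rwa [hid u hu.1, hid v hv.1] at h
  · intro h
    by_cases huv : u = v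
    · exact Or.inl huv
    · have hu := s₂ _ _ h huv
      have hv := s₂.right h₂ h huv
      exact Or.inr ⟨hu, hv, Or.inr ⟨by omega, by omega, by rwa [hid u hu.1, hid v hv.1]⟩⟩

end NextElt

open Classical in
/-- The non-crossing partitions of `{0, …, n - 1}` all of whose elements outside `[s, t)` are
singletons. -/
noncomputable def ncOn (n s t : ℕ) : Finset (Finpartition (univ : Finset (Fin n))) :=
  univ.filter fun π => NonCrossingRel π.rel ∧ SupportedOn s t π.rel

theorem mem_ncOn {n s t : ℕ} {π : Finpartition (univ : Finset (Fin n))} :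
    π ∈ ncOn n s t ↔ NonCrossingRel π.rel ∧ SupportedOn s t π.rel := by
  simp [ncOn]

theorem ncOn_univ (n : ℕ) : ncOn n 0 n = NC n := by
  ext π
  rw [mem_ncOn, nonCrossingRel_rel, and_iff_left]
  · simp [NC]
  · rintro u v (h | ⟨hu, -, -⟩) huv
    · exact absurd h huv
    · exact ⟨u.zero_le, hu⟩

/-- The partition with the relation `glueRel`. -/
noncomputable def glue {n : ℕ} (s p t : ℕ) (π₁ π₂ : Finpartition (univ : Finset (Fin n))) :
    Finpartition (univ : Finset (Fin n)) :=
  Finpartition.ofRel n (equivalence_glueRel (s := s) (p := p) (t := t) π₁.equivalence_rel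
    π₂.equivalence_rel)

/-- The partition with the relation `restrRel`. -/
noncomputable def restr {n : ℕ} (s t : ℕ) (π : Finpartition (univ : Finset (Fin n))) :
    Finpartition (univ : Finset (Fin n)) :=
  Finpartition.ofRel n (equivalence_restrRel (s := s) (t := t) π.equivalence_rel)

section Glue

variable {n s p t : ℕ} {π π₁ π₂ : Finpartition (univ : Finset (Fin n))}

theorem rel_restr (htn : t ≤ n) (u v : ℕ) : (restr s t π).rel u v ↔ restrRel s t π.rel u v :=
  Finpartition.rel_ofRel _
    (fun u v h huv => ((supportedOn_restrRel u v h huv).2.trans_le htn)) u v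

theorem rel_glue (hsp : s < p) (hpt : p ≤ t) (htn : t ≤ n) (h₂ : π₂ ∈ ncOn n p t) (u v : ℕ) :
    (glue s p t π₁ π₂).rel u v ↔ glueRel s p t π₁.rel π₂.rel u v :=
  Finpartition.rel_ofRel _
    (fun u v h huv => ((supportedOn_glueRel hsp hpt (mem_ncOn.1 h₂).2 u v h huv).2.trans_le htn))
    u v

theorem restr_mem_ncOn (htn : t ≤ n) (h : NonCrossingRel π.rel) : restr s t π ∈ ncOn n s t := by
  have : (restr s t π).rel = restrRel s t π.rel := by
    funext u v; exact propext (rel_restr htn u v)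
  rw [mem_ncOn, this]
  exact ⟨nonCrossingRel_restrRel h, supportedOn_restrRel⟩

/-- The bijection sends a partition to the successor `p = s + 1 + i` of `s` in its block (`p = t` if
there is none) and its restrictions to `(s, p)` and `[p, t)`. All partitions live on the same `Fin
n`, with singletons outside the interval, so no change of type is needed. -/
theorem sum_ncOn {M : Type*} [AddCommMonoid M] (hst : s < t) (htn : t ≤ n)
    (Φ : Finpartition (univ : Finset (Fin n)) → M) :
    ∑ π ∈ ncOn n s t, Φ π = ∑ i ∈ range (t - s), ∑ π₁ ∈ ncOn n (s + 1) (s + 1 + i),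
      ∑ π₂ ∈ ncOn n (s + 1 + i) t, Φ (glue s (s + 1 + i) t π₁ π₂) := by
  simp only [← Finset.sum_product']
  rw [Finset.sum_sigma']
  symm
  refine Finset.sum_bij' (fun x _ => glue s (s + 1 + x.1) t x.2.1 x.2.2)
    (fun π _ => ⟨nextElt s t π.rel - (s + 1), restr (s + 1) (nextElt s t π.rel) π,
      restr (nextElt s t π.rel) t π⟩) ?_ ?_ ?_ ?_ ?_
  · rintro ⟨i, π₁, π₂⟩ h
    obtain ⟨hi, h⟩ := Finset.mem_sigma.1 h
    obtain ⟨h₁, h₂⟩ := Finset.mem_product.1 h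
    rw [Finset.mem_range] at hi
    simp only at hi h₁ h₂
    have hrel : (glue s (s + 1 + i) t π₁ π₂).rel = glueRel s (s + 1 + i) t π₁.rel π₂.rel := by
      funext u v; exact propext (rel_glue (by omega) (by omega) htn h₂ u v)
    rw [mem_ncOn] at *
    rw [hrel]
    exact ⟨nonCrossingRel_glueRel (by omega) π₂.equivalence_rel h₂.2 h₁.1 h₂.1,
      supportedOn_glueRel (by omega) (by omega) h₂.2⟩
  · intro π h
    have h' := (mem_ncOn.1 h).1
    have h1 := nextElt_mem hst π.rel
    have h2 := nextElt_le (r := π.rel) hst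
    have h3 : s + 1 + (nextElt s t π.rel - (s + 1)) = nextElt s t π.rel := by omega
    refine Finset.mem_sigma.2 ⟨Finset.mem_range.2 ?_, Finset.mem_product.2 ⟨?_, ?_⟩⟩
    · simp only; omega
    · simp only [h3]
      exact restr_mem_ncOn (by omega) h'
    · simp only [h3]
      exact restr_mem_ncOn htn h'
  · rintro ⟨i, π₁, π₂⟩ h
    obtain ⟨hi, h⟩ := Finset.mem_sigma.1 h
    obtain ⟨h₁, h₂⟩ := Finset.mem_product.1 h
    rw [Finset.mem_range] at hi
    simp only at hi h₁ h₂
    have hrel : (glue s (s + 1 + i) t π₁ π₂).rel = glueRel s (s + 1 + i) t π₁.rel π₂.rel := by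
      funext u v; exact propext (rel_glue (by omega) (by omega) htn h₂ u v)
    have hnext : nextElt s t (glue s (s + 1 + i) t π₁ π₂).rel = s + 1 + i := by
      rw [hrel]; exact nextElt_glueRel (by omega) (by omega) π₂.equivalence_rel
    have e1 : restr (s + 1) (s + 1 + i) (glue s (s + 1 + i) t π₁ π₂) = π₁ :=
      Finpartition.rel_ext fun u v => by
        rw [rel_restr (by omega), hrel]
        exact restrRel_glueRel_left π₁.equivalence_rel (mem_ncOn.1 h₁).2 u v
    have e2 : restr (s + 1 + i) t (glue s (s + 1 + i) t π₁ π₂) = π₂ :=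
      Finpartition.rel_ext fun u v => by
        rw [rel_restr htn, hrel]
        exact restrRel_glueRel_right (by omega) π₂.equivalence_rel (mem_ncOn.1 h₂).2 u v
    simp only [hnext, e1, e2]
    congr 1
    omega
  · intro π h
    obtain ⟨hn, hs⟩ := mem_ncOn.1 h
    have h1 := nextElt_mem hst π.rel
    have h2 := nextElt_le (r := π.rel) hst
    have h3 : s + 1 + (nextElt s t π.rel - (s + 1)) = nextElt s t π.rel := by omega
    simp only [h3]
    refine Finpartition.rel_ext fun u v => ?_
    have e1 : (restr (s + 1) (nextElt s t π.rel) π).rel =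
        restrRel (s + 1) (nextElt s t π.rel) π.rel := by
      funext u v; exact propext (rel_restr (by omega) u v)
    have e2 : (restr (nextElt s t π.rel) t π).rel = restrRel (nextElt s t π.rel) t π.rel := by
      funext u v; exact propext (rel_restr htn u v)
    rw [rel_glue h1.1 h2 htn (restr_mem_ncOn htn hn), e1, e2]
    exact glueRel_restrRel hst π.equivalence_rel hn hs u v
  · intro x hx; rfl

end Glue

/-! ### Outer blocks and gaps of a glued partition. -/

theorem shiftTo_of_ne {s p t u : ℕ} (h : u ≠ s) : shiftTo s p t u = u := if_neg fun h' => h h'.1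

/-- The elements of `{0, …, n - 1}` that lie in `[s, t)`. -/
def interval (n s t : ℕ) : Finset (Fin n) := univ.filter fun i => s ≤ i ∧ i < t

@[simp] theorem mem_interval {n s t : ℕ} {i : Fin n} : i ∈ interval n s t ↔ s ≤ i ∧ (i : ℕ) < t := by
  simp [interval]

theorem interval_univ (n : ℕ) : interval n 0 n = univ := by ext i; simp

/-- The block of the least element of `S`, cut down to `S` (empty if `S` is). -/
def outerBlock {n : ℕ} (π : Finpartition (univ : Finset (Fin n))) (S : Finset (Fin n)) :
    Finset (Fin n) :=
  if hS : S.Nonempty then firstBlock π S hS else ∅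

section OuterBlock

variable {n s p t : ℕ} {π π₁ π₂ : Finpartition (univ : Finset (Fin n))}

theorem mem_outerBlock_interval {u : Fin n} :
    u ∈ outerBlock π (interval n s t) ↔ s ≤ u ∧ (u : ℕ) < t ∧ π.rel s u := by
  by_cases h : s ≤ u ∧ (u : ℕ) < t
  · have hs : s < n := h.1.trans_lt u.2
    have hne : (interval n s t).Nonempty := ⟨u, mem_interval.2 h⟩
    have hmin : (interval n s t).min' hne = ⟨s, hs⟩ := by
      have hmem : (⟨s, hs⟩ : Fin n) ∈ interval n s t :=
        mem_interval.2 ⟨le_refl s, h.1.trans_lt h.2⟩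
      have hmem' := mem_interval.1 (Finset.min'_mem _ hne)
      exact le_antisymm (Finset.min'_le _ _ hmem) (Fin.le_def.2 hmem'.1)
    rw [outerBlock, dif_pos hne, firstBlock, Finset.mem_inter, mem_interval, hmin,
      π.mem_part_iff_part_eq_part (mem_univ _) (mem_univ _), eq_comm, ← π.rel_fin]
    tauto
  · refine iff_of_false (fun hu => h ?_) (fun hu => h ⟨hu.1, hu.2.1⟩)
    rw [outerBlock] at hu
    split_ifs at hu with hS
    · exact mem_interval.1 (firstBlock_subset _ _ _ hu)
    · simp at hu

theorem outerBlock_subset (π : Finpartition (univ : Finset (Fin n))) (S : Finset (Fin n)) :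
    outerBlock π S ⊆ S := by
  rw [outerBlock]
  split_ifs
  · exact firstBlock_subset _ _ _
  · exact Finset.empty_subset _

/-- For `p < t` the element `s` joins the class of `p`; for `p = t` the block on the right is empty
and `{s}` is left. -/
theorem outerBlock_glue (hsp : s < p) (hpt : p ≤ t) (htn : t ≤ n) (h₂ : π₂ ∈ ncOn n p t) :
    outerBlock (glue s p t π₁ π₂) (interval n s t) =
      insert ⟨s, by omega⟩ (outerBlock π₂ (interval n p t)) := by
  ext u
  rw [mem_outerBlock_interval, Finset.mem_insert, mem_outerBlock_interval,
    rel_glue hsp hpt htn h₂]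
  by_cases hus : u = ⟨s, by omega⟩
  · subst hus
    refine iff_of_true ⟨le_rfl, hsp.trans_le hpt, ?_⟩ (Or.inl rfl)
    exact (equivalence_glueRel π₁.equivalence_rel π₂.equivalence_rel).refl _
  · have hus' : (u : ℕ) ≠ s := fun h => hus (Fin.ext h)
    simp only [hus, false_or]
    constructor
    · rintro ⟨h1, h2, ⟨h3, -⟩ | ⟨-, h3, h4⟩⟩
      · omega
      · have hpt' : p < t := by omega
        rw [shiftTo_of_ne hus', shiftTo, if_pos ⟨rfl, hpt'⟩] at h4
        exact ⟨by omega, h2, h4⟩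
    · rintro ⟨h1, h2, h3⟩
      refine ⟨by omega, h2, Or.inr ⟨by omega, by omega, ?_⟩⟩
      rwa [shiftTo_of_ne hus', shiftTo, if_pos ⟨rfl, by omega⟩]

theorem gapAfter_interval_fst (hsp : s < p) (hpt : p ≤ t) (htn : t ≤ n) :
    gapAfter (interval n s t) (insert ⟨s, by omega⟩ (outerBlock π₂ (interval n p t)))
      ⟨s, by omega⟩ = interval n (s + 1) p := by
  ext w
  rw [gapAfter, Finset.mem_filter, mem_interval, mem_interval, Fin.lt_def]
  constructor
  · rintro ⟨⟨h1, h2⟩, h3, h4⟩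
    refine ⟨h3, ?_⟩
    by_contra hpw
    have hp : p < n := by omega
    have := h4 ⟨p, hp⟩ (Finset.mem_insert_of_mem (mem_outerBlock_interval.2
      ⟨le_rfl, by simp only; omega, π₂.equivalence_rel.refl _⟩)) hsp
    exact hpw this
  · rintro ⟨h1, h2⟩
    refine ⟨⟨by omega, by omega⟩, h1, fun x hx hsx => ?_⟩
    rcases Finset.mem_insert.1 hx with rfl | hx
    · exact absurd hsx (lt_irrefl _)
    · exact Fin.lt_def.2 (h2.trans_le (mem_outerBlock_interval.1 hx).1)

theorem gapAfter_interval_snd (hsp : s < p) (hst : s < n) {v : Fin n} (hv : p ≤ v)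
    (V : Finset (Fin n)) :
    gapAfter (interval n s t) (insert ⟨s, hst⟩ V) v = gapAfter (interval n p t) V v := by
  ext w
  simp only [gapAfter, Finset.mem_filter, mem_interval, Finset.mem_insert, forall_eq_or_imp,
    Fin.lt_def]
  constructor
  · rintro ⟨⟨h1, h2⟩, h3, h4, h5⟩
    exact ⟨⟨by omega, h2⟩, h3, h5⟩
  · rintro ⟨⟨h1, h2⟩, h3, h5⟩
    exact ⟨⟨by omega, h2⟩, h3, by omega, h5⟩

end OuterBlock

/-! ### The moment-cumulant formula as a composition of series. -/

namespace OpValuedSpace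

variable {A B : Type*} [Ring A] [Algebra ℂ A] [Ring B] [Algebra ℂ B] (E : OpValuedSpace A B)

/-- The series of a family of multilinear maps, with constant term `1`. -/
def famSer (f : ∀ k : ℕ, MultilinearMap ℂ (fun _ : Fin k => A) B) : Ser A B :=
  ⟨fun l => match l with | [] => 1 | x :: l => Ser.ofMult f (x :: l)⟩

theorem famSer_of_ne_nil (f : ∀ k : ℕ, MultilinearMap ℂ (fun _ : Fin k => A) B) {l : List A}
    (hl : l ≠ []) : famSer f l = Ser.ofMult f l := by
  cases l with
  | nil => exact absurd rfl hl
  | cons x l => rfl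

theorem multiAdd_famSer (f : ∀ k : ℕ, MultilinearMap ℂ (fun _ : Fin k => A) B) :
    Ser.MultiAdd (famSer f) := by
  intro l x y l'
  rw [famSer_of_ne_nil f (by simp), famSer_of_ne_nil f (by simp), famSer_of_ne_nil f (by simp)]
  exact Ser.multiAdd_ofMult f l x y l'

/-- `nestedValue`, with the series `F` applied to the outer block. -/
noncomputable def outerValue {n : ℕ} (f : ∀ k : ℕ, MultilinearMap ℂ (fun _ : Fin k => A) B)
    (F : Ser A B) (π : Finpartition (univ : Finset (Fin n))) (a : Fin n → A) (S : Finset (Fin n)) :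
    B :=
  F (((outerBlock π S).sort).map fun v =>
    a v * E.incl (E.nestedValue f π a (gapAfter S (outerBlock π S) v)))

theorem nestedValue_eq_outerValue {n : ℕ} (f : ∀ k : ℕ, MultilinearMap ℂ (fun _ : Fin k => A) B)
    (π : Finpartition (univ : Finset (Fin n))) (a : Fin n → A) (S : Finset (Fin n)) :
    E.nestedValue f π a S = E.outerValue f (famSer f) π a S := by
  rw [nestedValue, outerValue]
  split_ifs with hS
  · have hV : outerBlock π S = firstBlock π S hS := dif_pos hS
    have hne : (firstBlock π S hS).Nonempty :=
      ⟨S.min' hS, Finset.mem_inter.2 ⟨π.mem_part (mem_univ _), S.min'_mem hS⟩⟩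
    rw [hV, famSer_of_ne_nil]
    · symm
      refine Ser.ofMult_eq f (by simp) fun i hi => ?_
      simp [Finset.orderEmbOfFin_apply]
    · rw [Ne, List.map_eq_nil_iff, ← List.length_eq_zero_iff, Finset.length_sort]
      exact (Finset.card_pos.2 hne).ne'
  · have hV : outerBlock π S = ∅ := dif_neg hS
    rw [hV]
    simp [famSer]

/-- `nestedValue` over `S` only depends on the restriction of the partition to `S`. -/
theorem nestedValue_congr_partition {n : ℕ} (f : ∀ k : ℕ, MultilinearMap ℂ (fun _ : Fin k => A) B)
    {π π' : Finpartition (univ : Finset (Fin n))} (a : Fin n → A) (S : Finset (Fin n))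
    (h : ∀ u ∈ S, ∀ v ∈ S, π.rel u v ↔ π'.rel u v) :
    E.nestedValue f π a S = E.nestedValue f π' a S := by
  induction hc : S.card using Nat.strong_induction_on generalizing S with
  | _ N ih =>
    have hV : outerBlock π S = outerBlock π' S := by
      unfold outerBlock
      split_ifs with hS
      · ext u
        simp only [firstBlock, Finset.mem_inter]
        refine and_congr_left fun hu => ?_
        rw [π.mem_part_iff_part_eq_part (mem_univ _) (mem_univ _),
          π'.mem_part_iff_part_eq_part (mem_univ _) (mem_univ _), ← π.rel_fin, ← π'.rel_fin]
        exact h _ hu _ (S.min'_mem hS)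
      · rfl
    rw [nestedValue_eq_outerValue, nestedValue_eq_outerValue, outerValue, outerValue, ← hV]
    congr 1
    refine List.map_congr_left fun v hv => ?_
    have hvS := outerBlock_subset π S ((Finset.mem_sort _).1 hv)
    rw [ih _ (hc ▸ card_gapAfter_lt _ hvS) _ _ rfl]
    exact fun u hu v hv => h u (Finset.filter_subset _ _ hu) v (Finset.filter_subset _ _ hv)

/-- The leg `s` is peeled off the outer block and absorbed into a derivative of `F`. This is why the
outer block carries its own series `F` while nested blocks keep `f`. -/
theorem outerValue_glue {n s p t : ℕ} (f : ∀ k : ℕ, MultilinearMap ℂ (fun _ : Fin k => A) B)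
    (F : Ser A B) {π₁ π₂ : Finpartition (univ : Finset (Fin n))} (a : Fin n → A)
    (hsp : s < p) (hpt : p ≤ t) (htn : t ≤ n) (h₂ : π₂ ∈ ncOn n p t) :
    E.outerValue f F (glue s p t π₁ π₂) a (interval n s t) =
      E.outerValue f (Ser.der (a ⟨s, by omega⟩ *
        E.incl (E.nestedValue f π₁ a (interval n (s + 1) p))) F) π₂ a (interval n p t) := by
  have hV : ∀ v ∈ outerBlock π₂ (interval n p t), p ≤ v :=
    fun v hv => (mem_outerBlock_interval.1 hv).1
  rw [outerValue, outerValue, outerBlock_glue hsp hpt htn h₂, Finset.sort_insert (· ≤ ·),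
    List.map_cons, Ser.der_apply, gapAfter_interval_fst hsp hpt htn]
  · congr 2
    · congr 2
      refine E.nestedValue_congr_partition f a _ fun u hu v hv => ?_
      rw [mem_interval] at hu hv
      rw [rel_glue hsp hpt htn h₂]
      constructor
      · rintro (⟨-, -, h⟩ | ⟨h, -, -⟩)
        · exact h
        · omega
      · exact fun h => Or.inl ⟨by omega, by omega, h⟩
    · refine List.map_congr_left fun v hv => ?_
      have hv' := hV v ((Finset.mem_sort _).1 hv)
      rw [gapAfter_interval_snd hsp _ hv']
      congr 2
      refine E.nestedValue_congr_partition f a _ fun u hu w hw => ?_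
      have hu' := mem_interval.1 (Finset.filter_subset _ _ hu)
      have hw' := mem_interval.1 (Finset.filter_subset _ _ hw)
      rw [rel_glue hsp hpt htn h₂, glueRel, shiftTo_of_ne (by omega), shiftTo_of_ne (by omega)]
      constructor
      · rintro (⟨h, -, -⟩ | ⟨-, -, h⟩)
        · omega
        · exact h
      · exact fun h => Or.inr ⟨by omega, by omega, h⟩
  · intro v hv
    have := hV v hv
    exact Fin.le_def.2 (by simp only; omega)
  · intro hs
    have := hV _ hs
    simp only at this
    omega

end OpValuedSpace

namespace Ser

theorem der_sum {X A ι : Type*} [AddCommGroup X] [AddCommGroup A] {α : Ser X A} (hα : MultiAdd α)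
    (s : Finset ι) (x : ι → X) : der (∑ i ∈ s, x i) α = ∑ i ∈ s, der (x i) α := by
  classical
  induction s using Finset.induction_on with
  | empty => simp [hα.der_zero]
  | insert i s hi ih => rw [Finset.sum_insert hi, Finset.sum_insert hi, hα.der_add, ih]

theorem sum_comp {V X A ι : Type*} [AddCommGroup A] (s : Finset ι) (α : ι → Ser X A)
    (β : Ser V X) (l : List V) : comp (∑ i ∈ s, α i) β l = ∑ i ∈ s, comp (α i) β l := by
  classical
  induction s using Finset.induction_on with
  | empty => simp
  | insert i s hi ih =>
    rw [Finset.sum_insert hi, Finset.sum_insert hi, add_comp, add_apply, ih]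

end Ser

namespace OpValuedSpace

open Ser

variable {A B : Type*} [Ring A] [Algebra ℂ A] [Ring B] [Algebra ℂ B] (E : OpValuedSpace A B)

theorem φ_one : E.φ 1 = 1 := by simpa using E.φ_incl 1

/-- The series of the moments. -/
def momSer : Ser A B := map E.φ prod

@[simp] theorem momSer_apply (l : List A) : E.momSer l = E.φ l.prod := rfl

/-- The series of the free cumulants, with constant term `1`. -/
noncomputable def cumSer : Ser A B := famSer E.cumulant

@[simp] theorem cumSer_nil : E.cumSer [] = 1 := rfl

/-- The words `a₁, …, aₙ` of a block: the first letter times the moment of the others. -/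
def blockSer : Ser A A := lin id * map E.incl E.momSer

theorem blockSer_cons (x : A) (l : List A) :
    E.blockSer (x :: l) = x * E.incl (E.φ l.prod) := lin_mul_cons _ _ _ _

theorem ncOn_self (n s : ℕ) : ncOn n s s = {Finpartition.ofRel n (eq_equivalence (α := ℕ))} := by
  have h : ∀ u v, (Finpartition.ofRel n (eq_equivalence (α := ℕ))).rel u v ↔ u = v :=
    Finpartition.rel_ofRel _ fun u v h h' => absurd h h'
  refine Finset.eq_singleton_iff_unique_mem.2 ⟨?_, fun π hπ => Finpartition.rel_ext fun u v => ?_⟩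
  · rw [mem_ncOn]
    constructor
    · intro i j k l _ _ _ h1 _
      rw [h] at h1
      omega
    · intro u v huv hne
      exact absurd ((h u v).1 huv) hne
  · rw [h]
    refine ⟨fun huv => ?_, fun huv => huv ▸ π.equivalence_rel.refl u⟩
    by_contra hne
    have := (mem_ncOn.1 hπ).2 u v huv hne
    omega

theorem sum_nestedValue_cumulant {l : List A} (hl : 0 < l.length) :
    ∑ π ∈ NC l.length, E.nestedValue E.cumulant π l.get univ = E.φ l.prod := by
  have h := congrArg (fun m => m l.get) (E.moment_eq_sum_cumulant hl)
  simp only [_root_.sum_apply] at h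
  refine Eq.trans h.symm ?_
  simp [moment, MultilinearMap.mkPiAlgebraFin_apply]

/-- By `sum_ncOn` both sides obey the same recursion: summing over `π₁` turns the gap after the
first leg into a moment, by additivity of `F`, and summing over `π₂` is the induction hypothesis for
a derivative of `F`. -/
theorem sum_outerValue {n : ℕ} (a : Fin n → A) {s t : ℕ} (hst : s ≤ t) (htn : t ≤ n)
    {F : Ser A B} (hF : MultiAdd F) :
    ∑ π ∈ ncOn n s t, E.outerValue E.cumulant F π a (interval n s t) =
      comp F E.blockSer (((List.ofFn a).drop s).take (t - s)) := by
  induction hN : t - s using Nat.strong_induction_on generalizing n s t F with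
  | _ N ih =>
    subst hN
    rcases hst.eq_or_lt with rfl | hlt
    · have h0 : interval n s s = ∅ := by
        ext u; simp [interval]
      have h1 : ∀ π : Finpartition (univ : Finset (Fin n)), outerBlock π (interval n s s) = ∅ :=
        fun π => by rw [h0]; exact dif_neg Finset.not_nonempty_empty
      rw [ncOn_self, Finset.sum_singleton, outerValue, h1]
      simp
    · -- the values of the parts that are nested into the first block
      have hnest : ∀ i, i < t - s →
          ∑ π ∈ ncOn n (s + 1) (s + 1 + i),
            E.nestedValue E.cumulant π a (interval n (s + 1) (s + 1 + i)) =
          E.φ ((((List.ofFn a).drop (s + 1)).take i).prod) := by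
        intro i hi
        simp only [nestedValue_eq_outerValue]
        have h1 := ih i hi a (s := s + 1) (t := s + 1 + i) (by omega) (by omega)
          (multiAdd_famSer E.cumulant) (by omega)
        rw [h1]
        set l := ((List.ofFn a).drop (s + 1)).take i with hl
        have hlen : l.length = i := by rw [hl]; simp; omega
        rcases Nat.eq_zero_or_pos i with rfl | hi0
        · rw [List.length_eq_zero_iff.1 hlen]
          simp [famSer, E.φ_one]
        -- The induction hypothesis is used again for the word `l` on its own ground set. Both sums
        -- equal the same composition, and the second one is a moment.
        · have h2 := ih i hi l.get (s := 0) (t := l.length) (by omega) le_rfl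
            (multiAdd_famSer E.cumulant) (by omega)
          simp only [← nestedValue_eq_outerValue] at h2
          rw [ncOn_univ, interval_univ, List.ofFn_get, List.drop_zero, ← hlen,
            List.take_length] at h2
          rw [← h2]
          exact E.sum_nestedValue_cumulant (by omega)
      rw [sum_ncOn hlt htn]
      have hcons : ((List.ofFn a).drop s).take (t - s) =
          a ⟨s, by omega⟩ :: ((List.ofFn a).drop (s + 1)).take (t - (s + 1)) := by
        rw [List.drop_eq_getElem_cons (by simp; omega)]
        obtain ⟨k, hk⟩ := Nat.exists_eq_add_of_lt hlt
        have h1 : t - s = k + 1 := by omega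
        have h2 : t - (s + 1) = k := by omega
        rw [h1, h2, List.take_succ_cons, List.getElem_ofFn]
      rw [hcons, comp_cons, bind_apply]
      have hlen : (((List.ofFn a).drop (s + 1)).take (t - (s + 1))).length + 1 = t - s := by
        simp; omega
      rw [hlen]
      refine Finset.sum_congr rfl fun i hi => ?_
      rw [Finset.mem_range] at hi
      have h1 : ∀ π₁ ∈ ncOn n (s + 1) (s + 1 + i), ∑ π₂ ∈ ncOn n (s + 1 + i) t,
          E.outerValue E.cumulant F (glue s (s + 1 + i) t π₁ π₂) a (interval n s t) =
          comp (der (a ⟨s, by omega⟩ * E.incl (E.nestedValue E.cumulant π₁ a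
            (interval n (s + 1) (s + 1 + i)))) F) E.blockSer
            (((List.ofFn a).drop (s + 1 + i)).take (t - (s + 1 + i))) := by
        intro π₁ _
        rw [← ih _ (by omega) a (by omega) htn (hF.der _) rfl]
        exact Finset.sum_congr rfl fun π₂ h₂ =>
          E.outerValue_glue _ F a (by omega) (by omega) htn h₂
      rw [Finset.sum_congr rfl h1, ← Ser.sum_comp, ← der_sum hF, ← Finset.mul_sum, ← map_sum,
        hnest i hi, der_apply, List.take_take, List.drop_take, List.drop_drop, blockSer_cons,
        min_eq_left (by omega)]
      congr 2
      omega

/-- The moment-cumulant formula as an identity of series. -/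
theorem momSer_eq : E.momSer = comp E.cumSer E.blockSer := by
  ext l
  rcases Nat.eq_zero_or_pos l.length with h | h
  · rw [List.length_eq_zero_iff.1 h]
    simp [E.φ_one]
  · have h2 := E.sum_outerValue l.get (s := 0) (t := l.length) (by omega) le_rfl
      (multiAdd_famSer E.cumulant)
    simp only [← nestedValue_eq_outerValue] at h2
    rw [ncOn_univ, interval_univ, List.ofFn_get, List.drop_zero, Nat.sub_zero,
      List.take_length] at h2
    exact (E.sum_nestedValue_cumulant h).symm.trans h2

end OpValuedSpace

/-! ### Right `B`-linearity of the cumulants in the last argument. -/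

namespace Ser

variable {V X A : Type*} [AddCommGroup A]

theorem bind_concat (δ : Ser V X) (f : X → Ser V A) (l : List V) (x : V) :
    bind δ f (l ++ [x]) =
      ∑ i ∈ range (l.length + 1), f (δ (l.take i)) (l.drop i ++ [x]) + f (δ (l ++ [x])) [] := by
  rw [bind_apply, List.length_append, List.length_singleton, Finset.sum_range_succ]
  congr 1
  · refine Finset.sum_congr rfl fun i hi => ?_
    rw [Finset.mem_range] at hi
    rw [List.take_append_of_le_length (by omega), List.drop_append_of_le_length (by omega)]
  · rw [List.take_of_length_le (by simp), List.drop_of_length_le (by simp)]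

theorem Agree.comp_left {n : ℕ} {α α' : Ser X A} (h : Agree n α α') (β : Ser V X) :
    Agree n (comp α β) (comp α' β) := fun l hl => by
  induction l using List.length_induction generalizing α α' n with
  | nil => simpa using h [] (by simpa using hl)
  | cons b l ih =>
    rw [comp_cons, comp_cons]
    refine bind_congr fun i hi => ih (l.drop i) (by simp) (n := n - 1) ?_ (by simp at hl ⊢; omega)
    intro l' hl'
    exact h _ (by simp; omega)

/-- Fewer blocks than letters would evaluate `α` on a word too short to give a nonzero value, so
every block is a single letter. -/
theorem comp_of_agree_zero {α : Ser X A} (β : Ser V X) {l : List V}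
    (h : Agree l.length α 0) : comp α β l = α (l.map fun x => β [x]) := by
  induction l generalizing α with
  | nil => simp
  | cons b l ih =>
    have hd : ∀ y, Agree l.length (der y α) 0 := fun y l' hl' => h (y :: l') (by simpa using hl')
    rw [comp_cons, bind_apply, Finset.sum_eq_single_of_mem 0 (by simp)]
    · exact ih (hd _)
    · intro i hi hi0
      have hlt : (l.drop i).length < l.length := by
        rw [Finset.mem_range] at hi
        rw [List.length_drop]; omega
      rw [(hd _).comp_left β _ hlt, zero_comp, zero_apply]

end Ser

namespace OpValuedSpace

open Ser

variable {A B : Type*} [Ring A] [Algebra ℂ A] [Ring B] [Algebra ℂ B] (E : OpValuedSpace A B)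

theorem φ_mul_incl (x : A) (b : B) : E.φ (x * E.incl b) = E.φ x * b := by
  simpa using E.φ_bimodule 1 x b

theorem φ_incl_mul (b : B) (x : A) : E.φ (E.incl b * x) = b * E.φ x := by
  simpa using E.φ_bimodule b x 1

/-- Right `B`-linearity in the last argument. -/
def RightLinear (F : Ser A B) : Prop :=
  ∀ (l : List A) (x : A) (b : B), F (l ++ [x * E.incl b]) = F (l ++ [x]) * b

theorem blockSer_concat (l : List A) (x : A) (b : B) :
    E.blockSer (l ++ [x * E.incl b]) = E.blockSer (l ++ [x]) * E.incl b := by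
  cases l with
  | nil => simp [blockSer_cons, E.φ_one]
  | cons y l =>
    simp only [List.cons_append, blockSer_cons, List.prod_append, List.prod_singleton,
      ← mul_assoc, φ_mul_incl, map_mul]

theorem RightLinear.comp {F : Ser A B} (hF : E.RightLinear F) :
    E.RightLinear (comp F E.blockSer) := by
  intro l
  induction l using List.length_induction generalizing F with
  | nil =>
    intro x b
    have := E.blockSer_concat [] x b
    rw [List.nil_append, List.nil_append] at *
    rw [comp_cons, comp_cons, bind_nil, bind_nil, comp_nil, comp_nil, der_apply, der_apply,
      der_apply, der_apply, this]
    exact hF [] _ b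
  | cons y l ih =>
    intro x b
    rw [List.cons_append, List.cons_append, comp_cons, comp_cons, bind_concat, bind_concat,
      add_mul, Finset.sum_mul]
    congr 1
    · refine Finset.sum_congr rfl fun i _ => ?_
      refine ih (l.drop i) (by simp) (F := der _ F) (fun l' => hF (_ :: l')) x b
    · have := E.blockSer_concat (y :: l) x b
      rw [List.cons_append, List.cons_append] at this
      rw [comp_nil, comp_nil, der_apply, der_apply, der_apply, der_apply, this]
      exact hF [] _ b

theorem rightLinear_momSer : E.RightLinear E.momSer := fun l x b => by
  simp [← mul_assoc, φ_mul_incl]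

/-- In `momSer_eq` the longest cumulant is the moment minus a composition involving shorter
cumulants only, which are right linear by induction. -/
theorem rightLinear_cumSer : E.RightLinear E.cumSer := by
  intro l
  induction hN : l.length using Nat.strong_induction_on generalizing l with
  | _ N ih =>
    classical
    -- `F` is the cumulant series truncated at length `N`; the remainder `cumSer - F` starts in
    -- length `N + 1` and so contributes only its value at the word itself.
    set F : Ser A B := ⟨fun l => if l.length ≤ N then E.cumSer l else 0⟩ with hFdef
    have hF : E.RightLinear F := fun l' x b => by
      simp only [hFdef, List.length_append, List.length_singleton]
      split_ifs with h
      · exact ih l'.length (by omega) l' rfl x b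
      · rw [zero_mul]
    have hG : ∀ x, E.cumSer (l ++ [x]) =
        E.momSer (l ++ [x]) - Ser.comp F E.blockSer (l ++ [x]) := by
      intro x
      have h1 : Agree (l ++ [x]).length (E.cumSer - F) 0 := fun l' hl' => by
        have : l'.length ≤ N := by simp at hl'; omega
        simp [hFdef, this]
      have h2 := comp_of_agree_zero E.blockSer h1
      have h3 : (l ++ [x]).map (fun x => E.blockSer [x]) = l ++ [x] := by
        refine (List.map_congr_left fun y _ => ?_).trans (List.map_id _)
        simp [blockSer_cons, E.φ_one]
      have h4 : F (l ++ [x]) = 0 := if_neg (by simp; omega)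
      rw [h3, Ser.sub_apply, h4, sub_zero] at h2
      rw [← h2, momSer_eq, eq_sub_iff_add_eq, ← Ser.add_apply, ← add_comp, sub_add_cancel]
    intro x b
    rw [hG, hG, sub_mul, E.rightLinear_momSer, (hF.comp E)]

theorem multiAdd_cumSer : MultiAdd E.cumSer := multiAdd_famSer E.cumulant

/-- The series `K_a`. -/
noncomputable def kSer (a : A) : Ser B B := ofMult (E.cumulantSeries a)

theorem kSer_apply (a : A) (l : List B) :
    E.kSer a l = E.cumSer (l.map (fun b => a * E.incl b) ++ [a]) := by
  rw [cumSer, famSer_of_ne_nil _ (by simp)]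
  symm
  refine ofMult_eq E.cumulant (n := l.length + 1) (by simp) fun i hi => ?_
  rcases Nat.lt_succ_iff_lt_or_eq.1 hi with h | rfl
  · rw [List.getElem_append_left (by simpa using h)]
    simp [Fin.snoc, h]
  · simp [Fin.snoc]

/-- The last leg of `K_a` carries no element of `B`. Right linearity moves the last letter out of
the cumulant, where it becomes the factor `lin id`. -/
theorem comap_cumSer (a : A) :
    comap (fun b => a * E.incl b) E.cumSer = 1 + E.kSer a * lin id := by
  ext l
  rcases l.eq_nil_or_concat with rfl | ⟨l, b, rfl⟩
  · simp
  · rw [List.concat_eq_append, Ser.add_apply, mul_lin_concat, kSer_apply, comap_apply, List.map_append, List.map_singleton,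
      E.rightLinear_cumSer]
    have : (1 : Ser B B) (l ++ [b]) = 0 := by cases l <;> rfl
    rw [this, zero_add, id]

/-! ### The equation for the expectation of a resolvent. -/

/-- The coefficientwise inclusion. -/
def inclSer : Ser B B →+* Ser B A := mapHom (E.incl : B →+* A)

/-- The coefficientwise conditional expectation. -/
def φSer : Ser B A →+ Ser B B where
  toFun := map E.φ
  map_zero' := by ext l; simp
  map_add' f g := by ext l; simp

@[simp] theorem inclSer_apply (f : Ser B B) (l : List B) : E.inclSer f l = E.incl (f l) := rfl
@[simp] theorem φSer_apply (f : Ser B A) (l : List B) : E.φSer f l = E.φ (f l) := rfl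

theorem φSer_inclSer_mul (f : Ser B B) (x : Ser B A) :
    E.φSer (E.inclSer f * x) = f * E.φSer x := by
  ext l; simp [mul_apply, φ_incl_mul]

theorem φSer_mul_inclSer (x : Ser B A) (f : Ser B B) :
    E.φSer (x * E.inclSer f) = E.φSer x * f := by
  ext l; simp [mul_apply, φ_mul_incl]

theorem φSer_one : E.φSer 1 = 1 := by
  ext l; cases l <;> simp [E.φ_one]

/-- The resolvent `(1 - a W)⁻¹`. -/
def resolvent (a : A) (W : Ser B B) : Ser B A := comp prod (scale a (E.inclSer W))

/-- Compose `momSer_eq` with `Z = a W`. The left side becomes `g`, and a block becomes `Z g = a (W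
g)`, so the cumulants are only evaluated at elements `a b` with `b ∈ B`, where `comap_cumSer`
expresses them through `K_a`. -/
theorem φSer_resolvent (a : A) {W : Ser B B} (hW : W [] = 0) :
    E.φSer (E.resolvent a W) = 1 + comp (E.kSer a) (W * E.φSer (E.resolvent a W)) *
      (W * E.φSer (E.resolvent a W)) := by
  set g := E.φSer (E.resolvent a W) with hg
  set Z := scale a (E.inclSer W) with hZ
  have hZ0 : Z [] = 0 := by simp [hZ, hW]
  have h1 : g = comp E.momSer Z := (map_comp E.φ.toAddMonoidHom prod Z).symm
  have h2 : comp (map E.incl E.momSer) Z = E.inclSer g := by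
    rw [h1]; exact map_comp (E.incl : B →+* A).toAddMonoidHom E.momSer Z
  have h3 : comp E.blockSer Z = map (fun b => a * E.incl b) (W * g) := by
    rw [blockSer, mul_comp, h2, lin_comp id hZ0]
    change Z * _ = _
    rw [hZ, scale_mul, ← map_mul]
    rfl
  have hWg : (W * g) [] = 0 := by simp [hW]
  conv_lhs => rw [h1, momSer_eq, comp_assoc E.multiAdd_cumSer E.blockSer Z, h3,
    ← comap_comp]
  rw [comap_cumSer, add_comp, one_comp, mul_comp, lin_comp id hWg]
  rfl

end OpValuedSpace

/-! ### The algebraic identity for the resolvent of a product. -/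

/-- If `X` and `Y` are the centred resolvents of `a η` and `b η`, then the resolvent of `a b η`
is obtained from the resolvent of a product of the two. -/
theorem one_sub_mul_resolvent_product {R : Type*} [Ring R] {a b η h U V X Y y W : R}
    (h₁ : h * (1 - η) = 1) (h₂ : (1 - η) * h = 1) (hU : U * (1 - a * η) = 1)
    (hU' : (1 - a * η) * U = 1) (hV : (1 - b * η) * V = 1)
    (hX : X = (1 - η) * (U * a) - 1) (hY : Y = V * b * (1 - η) - 1)
    (hy : y = (1 - η) * Y * (η * h)) (hW : (1 - X * y) * W = 1) :
    (1 - a * b * η) * (h * ((1 + y) * W * (1 + X * η))) = 1 := by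
  have hηh : η * h = h - 1 := by rw [sub_mul, one_mul] at h₂; rw [← h₂]; abel
  have hhη : h * η = h - 1 := by rw [mul_sub, mul_one] at h₁; rw [← h₁]; abel
  have hhX : h * X = U * a - h := by
    rw [hX, mul_sub, ← mul_assoc, h₁, one_mul, mul_one]
  have s1 : h * (1 + X * η) = U := by
    rw [mul_add, mul_one, ← mul_assoc, hhX, sub_mul, hhη]
    rw [mul_sub, mul_one, ← mul_assoc] at hU
    linear_combination (norm := noncomm_ring) -hU
  have hhy : h * y = Y * (η * h) := by
    rw [hy, ← mul_assoc, ← mul_assoc h, h₁, one_mul]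
  have s2 : b * (1 + η * Y) = 1 + Y := by
    have h3 : b * η * V = V - 1 := by
      rw [sub_mul, one_mul] at hV; rw [← hV]; abel
    calc b * (1 + η * Y) = b - b * η + b * η * V * b * (1 - η) := by rw [hY]; noncomm_ring
      _ = V * b * (1 - η) := by rw [h3]; noncomm_ring
      _ = 1 + Y := by rw [hY]; abel
  have s3 : (1 - a * η) * h * X = a * h - h := by
    rw [mul_assoc, hhX, mul_sub, ← mul_assoc, hU', one_mul]
    calc a - (1 - a * η) * h = a - h + a * (η * h) := by noncomm_ring
      _ = a * h - h := by rw [hηh]; noncomm_ring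
  -- The factor `b` is absorbed by `s2`; the remainder `(a - 1) h y` is recognised by `s3` as `(1 -
  -- a η) h X y`.
  have s4 : (1 - a * b * η) * (h * (1 + y)) = (1 - a * η) * h * (1 - X * y) := by
    calc (1 - a * b * η) * (h * (1 + y))
        = h + h * y - a * b * η * (h + h * y) := by noncomm_ring
      _ = h + Y * (η * h) - a * (b * (1 + η * Y)) * (η * h) := by rw [hhy]; noncomm_ring
      _ = (1 - a * η) * h - (a - 1) * (Y * (η * h)) := by rw [s2]; noncomm_ring
      _ = (1 - a * η) * h - (a - 1) * (h * y) := by rw [hhy]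
      _ = (1 - a * η) * h - (a * h - h) * y := by noncomm_ring
      _ = (1 - a * η) * h * (1 - X * y) := by rw [← s3]; noncomm_ring
  calc (1 - a * b * η) * (h * ((1 + y) * W * (1 + X * η)))
      = (1 - a * b * η) * (h * (1 + y)) * W * (1 + X * η) := by simp only [mul_assoc]
    _ = (1 - a * η) * h * ((1 - X * y) * W) * (1 + X * η) := by rw [s4]; simp only [mul_assoc]
    _ = (1 - a * η) * (h * (1 + X * η)) := by rw [hW]; simp only [mul_assoc, one_mul]
    _ = 1 := by rw [s1, hU']

/-! ### Series over a subalgebra, and freeness for series. -/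

namespace Ser

variable {V A : Type*} [Ring A]

/-- The series with coefficients in a subring. -/
def valued (V : Type*) (S : Subring A) : Subring (Ser V A) where
  carrier := {f | ∀ l, f l ∈ S}
  mul_mem' {f g} hf hg l := by
    rw [Ser.mul_apply]
    exact S.sum_mem fun i _ => S.mul_mem (hf _) (hg _)
  one_mem' l := by
    cases l with
    | nil => exact S.one_mem
    | cons b l => exact S.zero_mem
  add_mem' {f g} hf hg l := S.add_mem (hf l) (hg l)
  zero_mem' l := S.zero_mem
  neg_mem' {f} hf l := S.neg_mem (hf l)

theorem comp_prod_mem_valued {S : Subring A} {w : Ser V A} (hw : w ∈ valued V S) (hw0 : w [] = 0) :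
    comp prod w ∈ valued V S := by
  intro l
  induction l using List.length_induction with
  | nil => simp
  | cons b l ih =>
    rw [prod_comp_eq hw0, Ser.add_apply, mul_cons, hw0, zero_mul, zero_add, one_cons, zero_add]
    rw [Ser.mul_apply]
    exact S.sum_mem fun i _ => S.mul_mem (hw _) (ih _ (by simp))

/-- The constant series with value `a`. -/
def constSer (a : A) : Ser V A := scale a 1

theorem constSer_mul (a : A) (f : Ser V A) : constSer a * f = scale a f := by
  rw [constSer, scale_mul, one_mul]

theorem constSer_mul_constSer (a b : A) :
    (constSer a * constSer b : Ser V A) = constSer (a * b) := by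
  rw [constSer_mul]
  ext l
  simp [constSer, mul_assoc]

end Ser

namespace OpValuedSpace

open Ser

variable {A B : Type*} [Ring A] [Algebra ℂ A] [Ring B] [Algebra ℂ B] (E : OpValuedSpace A B)

/-- The word of centred elements, alternatingly from the algebras generated by `B` and `a` and by
`B` and `b`. -/
def IsCentredWord (a b : A) (L : List (Fin 2 × A)) : Prop :=
  L.IsChain (fun p q => p.1 ≠ q.1) ∧ ∀ p ∈ L, p.2 ∈ E.algGen (![a, b] p.1) ∧ E.φ p.2 = 0

variable {a b : A}

theorem IsCentredWord.concat {L : List (Fin 2 × A)} (hL : E.IsCentredWord a b L) {i : Fin 2}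
    (hi : ∀ p ∈ L.getLast?, p.1 ≠ i) {x : A} (hx : x ∈ E.algGen (![a, b] i)) (hφ : E.φ x = 0) :
    E.IsCentredWord a b (L ++ [(i, x)]) := by
  refine ⟨List.IsChain.append hL.1 (List.isChain_singleton _) ?_, fun p hp => ?_⟩
  · intro p hp q hq
    simp only [List.head?_cons, Option.mem_some_iff] at hq
    rw [← hq]
    exact hi p hp
  · rcases List.mem_append.1 hp with hp | hp
    · exact hL.2 p hp
    · rw [List.mem_singleton.1 hp]
      exact ⟨hx, hφ⟩

theorem AreFree.φ_prod_eq_zero (hf : E.AreFree a b) {L : List (Fin 2 × A)}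
    (hL : E.IsCentredWord a b L) (hne : L ≠ []) : E.φ (L.map Prod.snd).prod = 0 := by
  obtain ⟨p, L, rfl⟩ := List.exists_cons_of_ne_nil hne
  have h := hf L.length (fun j => ((p :: L).get j).1) (fun j => ((p :: L).get j).2) ?_ ?_ ?_
  · rw [← h]
    congr 2
    refine List.ext_getElem (by simp) fun i h1 h2 => by simp
  · intro j
    have := List.isChain_iff_getElem.1 hL.1 j (by simp)
    simpa using this
  · exact fun j => (hL.2 _ (List.get_mem _ _)).1
  · exact fun j => (hL.2 _ (List.get_mem _ _)).2

/-- Orthogonality to the centred words that do not end in the `i`-th algebra. -/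
def IsFreeFrom (a b : A) (i : Fin 2) (f : Ser B A) : Prop :=
  ∀ L, E.IsCentredWord a b L → (∀ p ∈ L.getLast?, p.1 ≠ i) →
    ∀ l, E.φ ((L.map Prod.snd).prod * f l) = 0

/-- The centred series over the `i`-th algebra. -/
def IsCentredSer (a b : A) (i : Fin 2) (x : Ser B A) : Prop :=
  x ∈ valued B (E.algGen (![a, b] i)).toSubring ∧ E.φSer x = 0

variable {E} {i j : Fin 2} {f g x y F : Ser B A}

theorem IsCentredSer.isFreeFrom (hf : E.AreFree a b) (hx : E.IsCentredSer a b i x) :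
    E.IsFreeFrom a b i x := fun L hL hi l => by
  have hφ : E.φ (x l) = 0 := congrArg (fun k : Ser B B => k l) hx.2
  have := hf.φ_prod_eq_zero E (hL.concat E hi (hx.1 l) hφ) (by simp)
  simpa using this

theorem IsFreeFrom.add (hf : E.IsFreeFrom a b i f) (hg : E.IsFreeFrom a b i g) :
    E.IsFreeFrom a b i (f + g) := fun L hL hi l => by
  rw [Ser.add_apply, mul_add, map_add, hf L hL hi, hg L hL hi, add_zero]

theorem IsFreeFrom.φSer_eq_zero (hf : E.IsFreeFrom a b i f) : E.φSer f = 0 := by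
  ext l
  have := hf [] ⟨List.isChain_nil, by simp⟩ (by simp) l
  simpa using this

/-- Each coefficient of `x` lengthens the centred test word by one letter of the `i`-th algebra, and
the longer word is admissible against `f`. -/
theorem IsCentredSer.mul_isFreeFrom (hx : E.IsCentredSer a b i x) (hij : i ≠ j)
    (hf : E.IsFreeFrom a b j f) : E.IsFreeFrom a b i (x * f) := fun L hL hi l => by
  rw [mul_apply, Finset.mul_sum, map_sum]
  refine Finset.sum_eq_zero fun k _ => ?_
  have hφ : E.φ (x (l.take k)) = 0 := congrArg (fun g : Ser B B => g _) hx.2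
  have := hf _ (hL.concat E hi (hx.1 (l.take k)) hφ) (by simpa using hij) (l.drop k)
  simpa [mul_assoc] using this

/-- `F` is `x + x y x + x y x y x + ⋯`. The property is stable under `f ↦ x + x y f`, and as `x y`
has no constant term, finitely many iterations give the right coefficients in any bounded degree. -/
theorem isFreeFrom_of_eq (hfree : E.AreFree a b) (hx : E.IsCentredSer a b i x)
    (hy : E.IsCentredSer a b j y) (hij : i ≠ j) (hxy : (x * y) [] = 0)
    (hF : F = x + x * y * F) : E.IsFreeFrom a b i F := by
  have key : ∀ n, ∃ f, E.IsFreeFrom a b i f ∧ Agree n F f := fun n => by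
    induction n with
    | zero => exact ⟨x, hx.isFreeFrom hfree, fun l hl => absurd hl (Nat.not_lt_zero _)⟩
    | succ n ih =>
      obtain ⟨f, hf, hFf⟩ := ih
      refine ⟨x + x * y * f, (hx.isFreeFrom hfree).add ?_, ?_⟩
      · rw [mul_assoc]
        exact hx.mul_isFreeFrom hij (hy.mul_isFreeFrom hij.symm hf)
      · have := (Agree.refl (n + 1) x).add (hFf.mul_left hxy)
        rwa [← hF] at this
  intro L hL hi l
  obtain ⟨f, hf, hFf⟩ := key (l.length + 1)
  rw [hFf l (Nat.lt_succ_self _), hf L hL hi]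

/-- The conditional expectation of `(1 + y) (1 - x y)⁻¹ (1 + x c)` for free centred `x` and `y`. -/
theorem φSer_free_resolvent (hfree : E.AreFree a b) (hx : E.IsCentredSer a b 0 x)
    (hy : E.IsCentredSer a b 1 y) (hy0 : y [] = 0) {W : Ser B A} (hW : (1 - x * y) * W = 1)
    (hW' : W * (1 - x * y) = 1) (c : Ser B B) :
    E.φSer ((1 + y) * W * (1 + x * E.inclSer c)) = 1 := by
  have h1 : W = 1 + x * (y * W) := by
    rw [sub_mul, one_mul, sub_eq_iff_eq_add] at hW
    rw [← mul_assoc]; exact hW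
  have h2 : W = 1 + W * x * y := by
    rw [mul_sub, mul_one, sub_eq_iff_eq_add] at hW'
    rw [mul_assoc]; exact hW'
  have hyW : E.IsFreeFrom a b 1 (y * W) := by
    refine isFreeFrom_of_eq hfree hy hx (by decide) (by simp [hy0]) ?_
    conv_lhs => rw [h1]
    noncomm_ring
  have hWx : E.IsFreeFrom a b 0 (W * x) := by
    refine isFreeFrom_of_eq hfree hx hy (by decide) (by simp [hy0]) ?_
    conv_lhs => rw [h1]
    noncomm_ring
  have e1 := (hx.mul_isFreeFrom (j := 1) (by decide) hyW).φSer_eq_zero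
  have e2 := (hy.mul_isFreeFrom (j := 0) (by decide) hWx).φSer_eq_zero
  have e3 : E.φSer W = 1 := by
    rw [h1, map_add, φSer_one, e1, add_zero]
  -- Of the four terms only `W` has nonzero expectation; `c` leaves `φ` on the right.
  have : (1 + y) * W * (1 + x * E.inclSer c) =
      W + y * W + W * x * E.inclSer c + y * (W * x) * E.inclSer c := by noncomm_ring
  rw [this, map_add, map_add, map_add, φSer_mul_inclSer, φSer_mul_inclSer, e2, e3,
    hyW.φSer_eq_zero, hWx.φSer_eq_zero]
  simp

end OpValuedSpace

/-! ### Inverses for concatenation that consist of multilinear maps. -/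

namespace MultSeries

variable {B : Type*} [Ring B] [Algebra ℂ B]

/-- The right inverse of a series with constant term `1`. -/
noncomputable def rightInv (α : MultSeries B) (n : ℕ) : MultilinearMap ℂ (fun _ : Fin n => B) B :=
  one n - ∑ k : Fin n, mulAt (Nat.succ_le_of_lt k.isLt) (α (k + 1)) (rightInv α (n - (k + 1)))
termination_by n
decreasing_by exact Nat.sub_lt k.pos (Nat.succ_pos _)

/-- Since `α₀ = 1`, the summand `k = 0` is the unknown itself and the others involve lower degrees.
-/
theorem concat_rightInv {α : MultSeries B} (h : ∀ v, α 0 v = 1) :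
    concat α (rightInv α) = one := by
  funext n
  rw [concat, Fin.sum_univ_succ]
  have h0 : mulAt (Nat.lt_succ_iff.mp (0 : Fin (n + 1)).isLt) (α (0 : Fin (n + 1)))
      (rightInv α (n - (0 : Fin (n + 1)))) = rightInv α n := by
    ext v
    rw [mulAt_apply]
    refine (congrArg (· * _) (h _)).trans ((one_mul _).trans ?_)
    change rightInv α n _ = rightInv α n v
    congr 1
    funext j
    congr 1
    ext
    simp
  rw [h0, rightInv]
  exact sub_add_cancel _ _

end MultSeries

/-! ### The `T`-transform through resolvents, and the product formula. -/

namespace OpValuedSpace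

open Ser

variable {A B : Type*} [Ring A] [Algebra ℂ A] [Ring B] [Algebra ℂ B] {E : OpValuedSpace A B}
  {a b : A}

theorem AreFree.φ_mul (hfree : E.AreFree a b) (ha : E.φ a = 1) (hb : E.φ b = 1) :
    E.φ (a * b) = 1 := by
  have hmem : ∀ x : A, x - 1 ∈ E.algGen x := fun x =>
    Subalgebra.sub_mem _ (Algebra.subset_adjoin (Or.inr rfl)) (Subalgebra.one_mem _)
  have h : E.IsCentredWord a b [(0, a - 1), (1, b - 1)] := by
    refine ⟨by simp, fun p hp => ?_⟩
    simp only [List.mem_cons, List.not_mem_nil, or_false] at hp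
    rcases hp with rfl | rfl
    · exact ⟨hmem a, by rw [map_sub, ha, E.φ_one, sub_self]⟩
    · exact ⟨hmem b, by rw [map_sub, hb, E.φ_one, sub_self]⟩
  have := hfree.φ_prod_eq_zero E h (by simp)
  have e : (a - 1) * (b - 1) = a * b - a - b + 1 := by noncomm_ring
  simp only [List.map_cons, List.map_nil, List.prod_cons, List.prod_nil, mul_one] at this
  rw [e, map_add, map_sub, map_sub, ha, hb, E.φ_one] at this
  simpa [sub_eq_zero] using this

variable (E)

/-- The series `T_a`. -/
noncomputable def tSer (a : A) : Ser B B := ofMult (E.tTransform a)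

theorem multiAdd_tSer (a : A) : MultiAdd (E.tSer a) := multiAdd_ofMult _

theorem kSer_eq (ha : E.φ a = 1) : E.kSer a = comp (E.tSer a) (lin id * E.kSer a) := by
  have := congrArg ofMult (E.cumulantSeries_eq_comp a ha)
  rwa [ofMult_comp, ofMult_concat, ofMult_ident] at this

theorem tSer_nil (ha : E.φ a = 1) : E.tSer a [] = 1 := by
  have h := congrArg (fun f : Ser B B => f []) (E.kSer_eq ha)
  rw [comp_nil] at h
  rw [← h]
  exact (E.cumulantSeries_zero a _).trans ha

theorem kSer_comp (ha : E.φ a = 1) {χ : Ser B B} (hχ : χ [] = 0) :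
    comp (E.kSer a) χ = comp (E.tSer a) (χ * comp (E.kSer a) χ) := by
  conv_lhs => rw [E.kSer_eq ha, comp_assoc (E.multiAdd_tSer a), mul_comp, lin_comp id hχ]
  rfl

/-- Both sides are fixed points of the contraction `f ↦ T_a × (ρ p' f)`: the left by `kSer_comp`,
the right because `ρ p' p = ρ`. -/
theorem kSer_comp_of_eq_comp (ha : E.φ a = 1) {p p' ρ : Ser B B} (hρ : ρ [] = 0)
    (hp : p = comp (E.tSer a) ρ) (h : p' * p = 1) : comp (E.kSer a) (ρ * p') = p := by
  have h0 : (ρ * p') [] = 0 := by simp [hρ]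
  refine eq_of_contraction (F := fun f => comp (E.tSer a) (ρ * p' * f))
    (fun n f g hfg => (hfg.mul_left h0).comp_right _) (E.kSer_comp ha h0) ?_
  rw [mul_assoc, h, mul_one]
  exact hp

/-- Put `χ = I r'` in `K_a × χ = T_a × (χ · (K_a × χ))`; since `χ r = I`, the right side is `T_a`.
-/
theorem tSer_eq_of_kSer_comp (ha : E.φ a = 1) {r r' : Ser B B} (h : r' * r = 1)
    (hr : comp (E.kSer a) (lin id * r') = r) : E.tSer a = r := by
  have := E.kSer_comp ha (χ := lin id * r') (by simp)
  rw [hr, mul_assoc, h, mul_one, comp_lin_id (E.multiAdd_tSer a)] at this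
  exact this.symm

/-- Converse use of `φSer_resolvent`: a series solving the equation is the expectation, by
uniqueness of the fixed point. -/
theorem φSer_resolvent_eq (a : A) {W Y g : Ser B B} (hW : W [] = 0)
    (hg : g = 1 + comp (E.kSer a) Y * Y) (hWg : W * g = Y) :
    E.φSer (E.resolvent a W) = g := by
  refine eq_of_contraction (F := fun f => 1 + comp (E.kSer a) (W * f) * (W * f))
    (fun n f g hfg => ?_) (E.φSer_resolvent a hW) (by rw [hWg]; exact hg)
  have := hfg.mul_left hW
  exact (Agree.refl _ _).add ((this.comp_right _).mul this)

theorem one_sub_mul_resolvent (a : A) {W : Ser B B} (hW : W [] = 0) :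
    (1 - constSer a * E.inclSer W) * E.resolvent a W = 1 := by
  rw [constSer_mul]
  exact one_sub_mul_prod_comp (by simp [hW])

theorem resolvent_mul_one_sub (a : A) {W : Ser B B} (hW : W [] = 0) :
    E.resolvent a W * (1 - constSer a * E.inclSer W) = 1 := by
  rw [constSer_mul]
  exact prod_comp_mul_one_sub (by simp [hW])

theorem inclSer_mem_valued (a : A) (f : Ser B B) :
    E.inclSer f ∈ valued B (E.algGen a).toSubring :=
  fun l => Algebra.subset_adjoin (Or.inl ⟨f l, rfl⟩)

theorem constSer_mem_valued (a : A) : constSer a ∈ valued B (E.algGen a).toSubring := fun l =>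
  Subalgebra.mul_mem _ (Algebra.subset_adjoin (Or.inr rfl))
    ((valued B (E.algGen a).toSubring).one_mem l)

theorem resolvent_mem_valued (a : A) {W : Ser B B} (hW : W [] = 0) :
    E.resolvent a W ∈ valued B (E.algGen a).toSubring := by
  refine comp_prod_mem_valued ?_ (by simp [hW])
  rw [← constSer_mul]
  exact Subring.mul_mem _ (E.constSer_mem_valued a) (E.inclSer_mem_valued a W)

/-- From `φ ((1 - a η)⁻¹) = (1 - η)⁻¹` to `φ ((1 - a η)⁻¹ a) = (1 - η)⁻¹`. -/
theorem φSer_resolvent_mul {x U : Ser B A} {η h : Ser B B} (h₁ : h * (1 - η) = 1)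
    (hU : U * (1 - x * E.inclSer η) = 1) (hφ : E.φSer U = h)
    (hη : ∀ f g : Ser B B, f * η = g * η → f = g) : E.φSer (U * x) = h := by
  refine hη _ _ ?_
  rw [mul_sub, mul_one, ← mul_assoc, sub_eq_iff_eq_add] at hU
  have := congrArg E.φSer hU
  rw [hφ, map_add, φSer_one, φSer_mul_inclSer] at this
  rw [mul_sub, mul_one, sub_eq_iff_eq_add] at h₁
  exact (add_left_cancel (h₁.symm.trans this)).symm

/-- The point is that both resolvents have the same expectation `h = (1 - η)⁻¹` at the same `η`. One
pair of factors `1 - η` then centres both, and the free expansion applies. -/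
theorem φSer_resolvent_product (hfree : E.AreFree a b) {x y U V : Ser B A} {η h : Ser B B}
    (hη0 : η [] = 0) (h₁ : h * (1 - η) = 1) (h₂ : (1 - η) * h = 1)
    (hη : ∀ f g : Ser B B, f * η = g * η → f = g)
    (hU : U * (1 - x * E.inclSer η) = 1) (hU' : (1 - x * E.inclSer η) * U = 1)
    (hV : V * (1 - y * E.inclSer η) = 1) (hV' : (1 - y * E.inclSer η) * V = 1)
    (hφU : E.φSer U = h) (hφV : E.φSer V = h)
    (hx : x ∈ valued B (E.algGen a).toSubring) (hUx : U ∈ valued B (E.algGen a).toSubring)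
    (hy : y ∈ valued B (E.algGen b).toSubring) (hVy : V ∈ valued B (E.algGen b).toSubring) :
    ∃ R, (1 - x * y * E.inclSer η) * R = 1 ∧ E.φSer R = h := by
  have eU := E.φSer_resolvent_mul h₁ hU hφU hη
  have eV := E.φSer_resolvent_mul h₁ hV hφV hη
  set X : Ser B A := (1 - E.inclSer η) * (U * x) - 1 with hX
  set Y : Ser B A := V * y * (1 - E.inclSer η) - 1 with hY
  -- The `B`-valued factors keep `y'` centred, and `η` removes its constant term, so `1 - X y'` is
  -- invertible.
  set y' : Ser B A := (1 - E.inclSer η) * Y * (E.inclSer η * E.inclSer h) with hy'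
  have i1 : (1 : Ser B A) - E.inclSer η = E.inclSer (1 - η) := by rw [map_sub, map_one]
  have i2 : E.inclSer η * E.inclSer h = E.inclSer (η * h) := by rw [map_mul]
  have φX : E.φSer X = 0 := by
    rw [hX, i1, map_sub, φSer_inclSer_mul, eU, h₂, φSer_one, sub_self]
  have φY : E.φSer Y = 0 := by
    rw [hY, i1, map_sub, φSer_mul_inclSer, eV, h₁, φSer_one, sub_self]
  have φy' : E.φSer y' = 0 := by
    rw [hy', i1, i2, φSer_mul_inclSer, φSer_inclSer_mul, φY, mul_zero, zero_mul]
  have cX : E.IsCentredSer a b 0 X := by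
    refine ⟨?_, φX⟩
    rw [hX, i1]
    exact Subring.sub_mem _ (Subring.mul_mem _ (E.inclSer_mem_valued a _)
      (Subring.mul_mem _ hUx hx)) (Subring.one_mem _)
  have cy' : E.IsCentredSer a b 1 y' := by
    refine ⟨?_, φy'⟩
    rw [hy', hY, i1, i2]
    exact Subring.mul_mem _ (Subring.mul_mem _ (E.inclSer_mem_valued b _)
      (Subring.sub_mem _ (Subring.mul_mem _ (Subring.mul_mem _ hVy hy)
        (E.inclSer_mem_valued b _)) (Subring.one_mem _))) (E.inclSer_mem_valued b _)
  have y'0 : y' [] = 0 := by simp [hy', hη0]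
  obtain ⟨W, hW, hW', -⟩ := exists_inverse (f := 1 - X * y') (by simp [y'0])
  have hι₁ : E.inclSer h * (1 - E.inclSer η) = 1 := by rw [i1, ← map_mul, h₁, map_one]
  have hι₂ : (1 - E.inclSer η) * E.inclSer h = 1 := by rw [i1, ← map_mul, h₂, map_one]
  refine ⟨_, one_sub_mul_resolvent_product hι₁ hι₂ hU hU' hV' hX hY hy' hW, ?_⟩
  rw [φSer_inclSer_mul, φSer_free_resolvent hfree cX cy' y'0 hW hW', mul_one]

/-- The product formula for the `T`-transform, as an identity of series. -/
theorem tSer_mul (hfree : E.AreFree a b) (ha : E.φ a = 1) (hb : E.φ b = 1) {q' : Ser B B}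
    (hq : E.tSer b * q' = 1) (hq' : q' * E.tSer b = 1) :
    E.tSer (a * b) = comp (E.tSer a) (E.tSer b * lin id * q') * E.tSer b := by
  set q := E.tSer b with hqdef
  set ρ := q * lin id * q' with hρ
  have hρ0 : ρ [] = 0 := by simp [hρ]
  set p := comp (E.tSer a) ρ with hpdef
  obtain ⟨p', hp, hp', -⟩ := exists_inverse (f := p) (by simp [hpdef, E.tSer_nil ha])
  obtain ⟨h', hh, hh', -⟩ := exists_inverse (f := 1 + ρ) (by simp [hρ0])
  set h := 1 + ρ with hhdef
  -- This is `1 - h⁻¹`, so that `(1 - η)⁻¹ = 1 + ρ`.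
  set η := ρ * h' with hηdef
  have hη0 : η [] = 0 := by simp [hηdef, hρ0]
  have hηh : η * h = ρ := by rw [hηdef, mul_assoc, hh', mul_one]
  have hhη : h * η = ρ := by
    have : h * ρ = ρ * h := by rw [hhdef, add_mul, mul_add, one_mul, mul_one]
    rw [hηdef, ← mul_assoc, this, mul_assoc, hh, mul_one]
  have h₁ : h * (1 - η) = 1 := by rw [mul_sub, mul_one, hhη, hhdef, add_sub_cancel_right]
  have h₂ : (1 - η) * h = 1 := by rw [sub_mul, one_mul, hηh, hhdef, add_sub_cancel_right]
  have hρq : ρ * q = q * lin id := by rw [hρ, mul_assoc, hq', mul_one]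
  have hq'ρ : q' * ρ = lin id * q' := by rw [hρ, ← mul_assoc, ← mul_assoc, hq', one_mul]
  -- `η` is not invertible, but `f η h q = f ρ q = f q I`, and `I` can be cancelled on the right.
  have hcancel : ∀ f g : Ser B B, f * η = g * η → f = g := fun f g hfg => by
    have e : ∀ f : Ser B B, f * η * h * q = f * q * lin id := fun f => by
      rw [mul_assoc f, hηh, mul_assoc, hρq, mul_assoc]
    have h3 : f * q = g * q := mul_lin_id_cancel (by rw [← e, ← e, hfg])
    calc f = f * q * q' := by rw [mul_assoc, hq, mul_one]
      _ = g := by rw [h3, mul_assoc, hq, mul_one]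
  -- the resolvent of `a`
  have hWa0 : (η * p') [] = 0 := by simp [hη0]
  have hφa : E.φSer (E.resolvent a (η * p')) = p * h * p' := by
    refine E.φSer_resolvent_eq a (Y := ρ * p') hWa0 ?_ ?_
    · rw [E.kSer_comp_of_eq_comp ha hρ0 hpdef hp', hhdef, mul_add, mul_one, add_mul, hp, mul_assoc]
    · calc η * p' * (p * h * p') = η * (p' * p) * h * p' := by simp only [mul_assoc]
        _ = ρ * p' := by rw [hp', mul_one, hηh]
  -- the resolvent of `b`
  have hWb0 : (q' * η) [] = 0 := by simp [hη0]
  have hφb : E.φSer (E.resolvent b (q' * η)) = h := by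
    refine E.φSer_resolvent_eq b (Y := lin id * q') hWb0 ?_ ?_
    · rw [E.kSer_comp_of_eq_comp hb (lin_nil id) (comp_lin_id (E.multiAdd_tSer b)).symm hq',
        hhdef, ← mul_assoc]
    · rw [mul_assoc, hηh, hq'ρ]
  have ιp : E.inclSer p * E.inclSer p' = 1 := by rw [← map_mul, hp, map_one]
  have ιp' : E.inclSer p' * E.inclSer p = 1 := by rw [← map_mul, hp', map_one]
  have e1 : E.inclSer p' * constSer a * E.inclSer η =
      E.inclSer p' * (constSer a * E.inclSer (η * p')) * E.inclSer p := by
    simp only [map_mul, mul_assoc, ιp', mul_one]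
  have e2 : constSer b * E.inclSer q' * E.inclSer η = constSer b * E.inclSer (q' * η) := by
    simp only [map_mul, mul_assoc]
  -- `a` enters as `p' a`: conjugation by `p` takes the resolvent of `a` at `η p'`, of expectation
  -- `p h p'`, to that of `p' a` at `η`, of expectation `h`. For `b` the factor `q'` suffices.
  obtain ⟨R, hR, hφR⟩ := E.φSer_resolvent_product hfree (x := E.inclSer p' * constSer a)
    (y := constSer b * E.inclSer q') (U := E.inclSer p' * E.resolvent a (η * p') * E.inclSer p)
    (V := E.resolvent b (q' * η)) hη0 h₁ h₂ hcancel
    (by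
      have := E.resolvent_mul_one_sub a hWa0
      rw [e1]
      set S := E.resolvent a (η * p')
      set Z := constSer a * E.inclSer (η * p')
      calc E.inclSer p' * S * E.inclSer p * (1 - E.inclSer p' * Z * E.inclSer p)
          = E.inclSer p' * S * E.inclSer p
            - E.inclSer p' * S * (E.inclSer p * E.inclSer p') * Z * E.inclSer p := by noncomm_ring
        _ = E.inclSer p' * (S * (1 - Z)) * E.inclSer p := by rw [ιp]; noncomm_ring
        _ = 1 := by rw [this, mul_one, ιp'])
    (by
      have := E.one_sub_mul_resolvent a hWa0
      rw [e1]
      set S := E.resolvent a (η * p')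
      set Z := constSer a * E.inclSer (η * p')
      calc (1 - E.inclSer p' * Z * E.inclSer p) * (E.inclSer p' * S * E.inclSer p)
          = E.inclSer p' * S * E.inclSer p
            - E.inclSer p' * Z * (E.inclSer p * E.inclSer p') * S * E.inclSer p := by noncomm_ring
        _ = E.inclSer p' * ((1 - Z) * S) * E.inclSer p := by rw [ιp]; noncomm_ring
        _ = 1 := by rw [this, mul_one, ιp'])
    (by rw [e2]; exact E.resolvent_mul_one_sub b hWb0)
    (by rw [e2]; exact E.one_sub_mul_resolvent b hWb0)
    (by
      rw [φSer_mul_inclSer, φSer_inclSer_mul, hφa]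
      calc p' * (p * h * p') * p = (p' * p) * h * (p' * p) := by simp only [mul_assoc]
        _ = h := by rw [hp', one_mul, mul_one])
    hφb
    (Subring.mul_mem _ (E.inclSer_mem_valued a _) (E.constSer_mem_valued a))
    (Subring.mul_mem _ (Subring.mul_mem _ (E.inclSer_mem_valued a _)
      (E.resolvent_mem_valued a hWa0)) (E.inclSer_mem_valued a _))
    (Subring.mul_mem _ (E.constSer_mem_valued b) (E.inclSer_mem_valued b _))
    (E.resolvent_mem_valued b hWb0)
  -- the resolvent of `a b`
  set z := q' * η * p' with hz
  have hz0 : z [] = 0 := by simp [hz, hη0]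
  have hres : E.resolvent (a * b) z = E.inclSer p * R * E.inclSer p' := by
    refine left_inv_eq_right_inv (E.resolvent_mul_one_sub (a * b) hz0) ?_
    have e3 : constSer (a * b) * E.inclSer z * E.inclSer p =
        E.inclSer p * (E.inclSer p' * constSer a * (constSer b * E.inclSer q') * E.inclSer η) := by
      rw [← constSer_mul_constSer, hz]
      simp only [map_mul, mul_assoc, ιp', mul_one]
      rw [← mul_assoc (E.inclSer p), ιp, one_mul]
    calc (1 - constSer (a * b) * E.inclSer z) * (E.inclSer p * R * E.inclSer p')
        = (E.inclSer p - constSer (a * b) * E.inclSer z * E.inclSer p) * R * E.inclSer p' := by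
          noncomm_ring
      _ = E.inclSer p * ((1 - E.inclSer p' * constSer a * (constSer b * E.inclSer q') *
            E.inclSer η) * R) * E.inclSer p' := by rw [e3]; noncomm_ring
      _ = 1 := by rw [hR, mul_one, ιp]
  have hφab : E.φSer (E.resolvent (a * b) z) = p * h * p' := by
    rw [hres, φSer_mul_inclSer, φSer_inclSer_mul, hφR]
  have hzg : z * (p * h * p') = lin id * (q' * p') := by
    calc z * (p * h * p') = q' * (η * (p' * p) * h) * p' := by rw [hz]; simp only [mul_assoc]
      _ = lin id * (q' * p') := by rw [hp', mul_one, hηh, hq'ρ, mul_assoc]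
  -- With the known expectation this reads `p h p' = 1 + k I q' p'`, where `k = K_ab × (I q' p')`;
  -- solving for `k` gives `p q`.
  have hK := E.φSer_resolvent (a * b) hz0
  rw [hφab, hzg] at hK
  have hr : q' * p' * (p * q) = 1 := by
    calc q' * p' * (p * q) = q' * (p' * p) * q := by simp only [mul_assoc]
      _ = 1 := by rw [hp', mul_one, hq']
  refine E.tSer_eq_of_kSer_comp (hfree.φ_mul ha hb) hr (mul_lin_id_cancel ?_)
  set k := comp (E.kSer (a * b)) (lin id * (q' * p'))
  have hK' : k * (lin id * (q' * p')) = p * ρ * p' := by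
    have e4 : p * h * p' = 1 + p * ρ * p' := by
      rw [hhdef, mul_add, mul_one, add_mul, hp]
    exact (add_left_cancel (e4.symm.trans hK)).symm
  calc k * lin id = k * (lin id * (q' * p')) * (p * q) := by
        rw [mul_assoc k, mul_assoc (lin id), hr, mul_one]
    _ = p * (ρ * (p' * p) * q) := by rw [hK']; simp only [mul_assoc]
    _ = p * q * lin id := by rw [hp', mul_one, hρq, mul_assoc]

end OpValuedSpace

open OpValuedSpace Ser in
theorem mainTheorem1 {A B : Type*} [Ring A] [Algebra ℂ A] [Ring B] [Algebra ℂ B]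
    (E : OpValuedSpace A B) (a b : A) (ha : E.φ a = 1) (hb : E.φ b = 1)
    (hfree : E.AreFree a b) :
    E.φ (a * b) = 1 ∧
    ∃ S : MultSeries B,
      MultSeries.concat (E.tTransform b) S = MultSeries.one ∧
      MultSeries.concat S (E.tTransform b) = MultSeries.one ∧
      E.tTransform (a * b) =
        MultSeries.concat
          (MultSeries.comp (E.tTransform a)
            (MultSeries.concat (MultSeries.concat (E.tTransform b) MultSeries.ident) S))
          (E.tTransform b) := by
  have h0 : ∀ v, E.tTransform b 0 v = 1 := fun v => by
    rw [← E.tSer_nil hb]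
    exact congrArg _ (Subsingleton.elim _ _)
  have h1 := MultSeries.concat_rightInv h0
  have hq : E.tSer b * ofMult (MultSeries.rightInv (E.tTransform b)) = 1 := by
    rw [tSer, ← ofMult_concat, h1, ofMult_one]
  -- The right inverse was built from multilinear maps; that it is also a left inverse follows in
  -- the ring `Ser`, where a two-sided inverse exists and is unique.
  have hq' : ofMult (MultSeries.rightInv (E.tTransform b)) * E.tSer b = 1 := by
    obtain ⟨g, hg, hg', -⟩ := exists_inverse (E.tSer_nil hb)
    rwa [← left_inv_eq_right_inv hg' hq]
  refine ⟨hfree.φ_mul ha hb, MultSeries.rightInv (E.tTransform b), h1, ofMult_injective ?_,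
    ofMult_injective ?_⟩
  · rw [ofMult_concat, ofMult_one]
    exact hq'
  · rw [ofMult_concat, ofMult_comp, ofMult_concat, ofMult_concat, ofMult_ident]
    exact E.tSer_mul hfree ha hb hq hq'
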